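/- Let $V$ be a complex vector space with basis $e_{-n},\dots,e_n$ and the symmetric bilinear form $\beta$ with $\beta(e_i,e_j)=1$ if $i=-j$ and $0$ otherwise, and let $B_n$ be the Grassmannian of isotropic $n$-dimensional subspaces of $V$. Let $\mathbb{SY}_n$ be the set of sequences $n\ge\lambda_1>\dots>\lambda_n\ge -n$ with $\{|\lambda_1|,\dots,|\lambda_n|\}=\{1,\dots,n\}$, and put $$X_\mu=\{H\in B_n\mid \dim H\cap\langle e_{\mu_j},\dots,e_n\rangle\ge j,\ 1\le j\le n\},$$ $$X'_{\lambda^c}=\{H\in B_n\mid \dim H\cap\langle e_{-n},\dots,e_{\lambda_j}\rangle\ge n+1-j,\ 1\le j\le n\}.$$ Let $\mu,\lambda\in\mathbb{SY}_n$ with $\mu_j\le\lambda_j$ for all $j$. The boxes of $\lambda/\mu$ are the pairs (row $j$, column $c$) with $c\ge1$ and $\mu_j<c\le\lambda_j$; boxes that share an edge or a vertex are connected, which defines the components of $\lambda/\mu$. For a component $d$, let $\mathrm{col}(d)$ be the set of columns of $d$ together with the column just to the left of $d$; let $d_0$ be the component with $0\in\mathrm{col}(d_0)$, if there is one. Put $V_\varphi=\langle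 e_{\mu_j},e_{-\mu_j}\mid \mu_j=\lambda_j\rangle$, $V_0=\langle e_0,e_k,e_{-k}\mid k\in\mathrm{col}(d_0)\rangle$ (which is $\langle e_0\rangle$ if there is no $d_0$) and, for $0\notin\mathrm{col}(d)$, $V_d^-=\langle e_k\mid k\in\mathrm{col}(d)\rangle$ and $V_d^+=\langle e_{-k}\mid k\in\mathrm{col}(d)\rangle$. For $H\in X_\mu\cap X'_{\lambda^c}$ let $H_0=H\cap V_0$ and $H_d=(H\cap V_d^+)\oplus(H\cap V_d^-)$. Then: 1. $H\cap V_\varphi$ is the same subspace $H_\varphi:=\langle e_{\mu_j}\mid\mu_j=\lambda_j\rangle$ for all $H\in X_\mu\cap X'_{\lambda^c}$. 2. The map $$\{H_0\mid H\in X_\mu\cap X'_{\lambda^c}\}\times\prod_{0\notin\mathrm{col}(d)}\{H_d\mid H\in X_\mu\cap X'_{\lambda^c}\}\longrightarrow X_\mu\cap X'_{\lambda^c},\qquad (H_0,\dots,H_d,\dots)\longmapsto\langle H_\varphi,H_0,\dots,H_d,\dots\rangle,$$ is a well-defined isomorphism of algebraic varieties (a bijection that is regular in both directions). 3. Each factor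 is an intersection of two Schubert varieties in an orthogonal Grassmannian. Let $C=\mathrm{col}(d)$ for the factor of the $H_d$, and let $C$ be the set of positive elements of $\mathrm{col}(d_0)$ for the factor of the $H_0$ ($C=\emptyset$ if there is no $d_0$). Let $p=\#C$ and $a=\min C$ (if $C\neq\emptyset$). The entries $\mu_i$ with $|\mu_i|\in C$, with $a-1$ subtracted from their absolute values, form in decreasing order a sequence $\mu'\in\mathbb{SY}_p$; likewise $\lambda$ gives $\lambda'\in\mathbb{SY}_p$, and $\mu'_j\le\lambda'_j$ for all $j$. Under the embedding $\mathbb{C}^{2p+1}\to V$ with $e_0\mapsto e_0$ and $e_{\pm i}\mapsto e_{\pm(i+a-1)}$ for $1\le i\le p$, the factor is exactly the image of $X_{\mu'}\cap X'_{(\lambda')^c}\subset B_p$. -/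

import Mathlib

/-! ## The quadratic space `V = ℂ^(2n+1)` -/

/-- The indices `-n, …, -1, 0, 1, …, n` of the basis of `V`. -/
abbrev Idx (n : ℕ) : Type := {i : ℤ // i ∈ Finset.Icc (-(n : ℤ)) n}

/-- The space `V` of dimension `2n+1`, in the coordinates `x_{-n}, …, x_n`. -/
abbrev V (n : ℕ) : Type := Idx n → ℂ

/-- The basis vector `e_i` for `-n ≤ i ≤ n` (and `0` for all other integers `i`). -/
def e (n : ℕ) (i : ℤ) : V n := fun k => if (k : ℤ) = i then 1 else 0

/-- The symmetric bilinear form with `β(e_i, e_j) = 1` if `i = -j`, and `0` otherwise. -/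
noncomputable def beta (n : ℕ) : LinearMap.BilinForm ℂ (V n) :=
  Matrix.toBilin' (Matrix.of fun i j : Idx n => if (i : ℤ) = -(j : ℤ) then (1 : ℂ) else 0)

/-- The span of the `e_i` with `i ∈ S`. -/
def coordSpan (n : ℕ) (S : Set ℤ) : Submodule ℂ (V n) := Submodule.span ℂ (e n '' S)

/-- The Grassmannian `B_n` of isotropic `n`-dimensional subspaces of `V`. -/
def orthGrass (n : ℕ) : Set (Submodule ℂ (V n)) :=
  {H | (∀ x ∈ H, ∀ y ∈ H, beta n x y = 0) ∧ Module.finrank ℂ H = n}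

/-! ## Schubert varieties -/

/-- Sequences `n ≥ λ_1 > ⋯ > λ_n ≥ -n` whose absolute values are `1, …, n`;
`λ_j` is `seq (j - 1)`. -/
structure SY (n : ℕ) where
  seq : Fin n → ℤ
  strictAnti : StrictAnti seq
  range_abs : Set.range (fun j => |seq j|) = Set.Icc (1 : ℤ) n

/-- The Bruhat order. -/
def bruhatLE {n : ℕ} (mu lam : SY n) : Prop := ∀ j, mu.seq j ≤ lam.seq j

/-- The Schubert variety `X_μ`: `dim H ∩ ⟨e_{μ_j}, …, e_n⟩ ≥ j` for `1 ≤ j ≤ n`. -/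
def schubert {n : ℕ} (mu : SY n) : Set (Submodule ℂ (V n)) :=
  {H | H ∈ orthGrass n ∧ ∀ j : Fin n,
    (j : ℕ) + 1 ≤ Module.finrank ℂ ↥(H ⊓ coordSpan n (Set.Icc (mu.seq j) n))}

/-- The opposite Schubert variety `X'_{λ^c}`:
`dim H ∩ ⟨e_{-n}, …, e_{λ_j}⟩ ≥ n + 1 - j` for `1 ≤ j ≤ n`. -/
def schubertOpp {n : ℕ} (lam : SY n) : Set (Submodule ℂ (V n)) :=
  {H | H ∈ orthGrass n ∧ ∀ j : Fin n,
    n - (j : ℕ) ≤ Module.finrank ℂ ↥(H ⊓ coordSpan n (Set.Icc (-(n : ℤ)) (lam.seq j)))}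

/-! ## The skew diagram `λ/μ` and its components -/

/-- The boxes of `λ/μ`, as pairs (row, column); the columns are `1, 2, …`. -/
abbrev Box {n : ℕ} (mu lam : SY n) : Type :=
  {b : Fin n × ℤ // 1 ≤ b.2 ∧ mu.seq b.1 < b.2 ∧ b.2 ≤ lam.seq b.1}

/-- Two boxes are joined if they share an edge or a vertex. -/
def boxGraph {n : ℕ} (mu lam : SY n) : SimpleGraph (Box mu lam) where
  Adj b c := b ≠ c ∧ |((b.1.1 : ℕ) : ℤ) - ((c.1.1 : ℕ) : ℤ)| ≤ 1 ∧ |b.1.2 - c.1.2| ≤ 1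
  symm := ⟨fun b c h => ⟨h.1.symm, by rw [abs_sub_comm]; exact h.2.1,
    by rw [abs_sub_comm]; exact h.2.2⟩⟩
  loopless := ⟨fun b h => h.1 rfl⟩

/-- The components of `λ/μ`. -/
abbrev Component {n : ℕ} (mu lam : SY n) : Type := (boxGraph mu lam).ConnectedComponent

/-- The columns met by a component `d`. -/
def boxCols {n : ℕ} {mu lam : SY n} (d : Component mu lam) : Set ℤ :=
  {k | ∃ b : Box mu lam, (boxGraph mu lam).connectedComponentMk b = d ∧ b.1.2 = k}

/-- `col(d)`: the columns of `d`, together with the column just to the left of `d`. -/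
def col {n : ℕ} {mu lam : SY n} (d : Component mu lam) : Set ℤ :=
  boxCols d ∪ {k | IsLeast (boxCols d) (k + 1)}

/-- The index set of the factors: `none` stands for the factor of the `H_0`, and `some d` for
the factor of the `H_d`, where `d` is a component with `0 ∉ col(d)`. -/
abbrev FactorIdx {n : ℕ} (mu lam : SY n) : Type :=
  Option {d : Component mu lam // (0 : ℤ) ∉ col d}

/-- The positive columns of a factor: the positive members of `col(d_0)` for `none`, where `d_0`
is the component that meets the first column (no columns if there is none), and `col(d)` for
`some d`. -/
def factorCols {n : ℕ} {mu lam : SY n} : FactorIdx mu lam → Set ℤ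
  | none => {k | 1 ≤ k ∧ ∃ d : Component mu lam, (0 : ℤ) ∈ col d ∧ k ∈ col d}
  | some d => col d.1

/-- The number of positive columns of a factor; this is the dimension of the `H_0` or `H_d`. -/
noncomputable def factorDim {n : ℕ} {mu lam : SY n} (c : FactorIdx mu lam) : ℕ :=
  (factorCols c).ncard

/-! ## The subspaces `V_φ`, `V_0`, `V_d`, and the factors -/

/-- `V_φ = ⟨e_{μ_j}, e_{-μ_j} ∣ μ_j = λ_j⟩`. -/
def Vphi {n : ℕ} (mu lam : SY n) : Submodule ℂ (V n) :=
  coordSpan n {i | ∃ j, mu.seq j = lam.seq j ∧ (i = mu.seq j ∨ i = -mu.seq j)}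

/-- `H_φ = ⟨e_{μ_j} ∣ μ_j = λ_j⟩`. -/
def Hphi {n : ℕ} (mu lam : SY n) : Submodule ℂ (V n) :=
  coordSpan n {i | ∃ j, mu.seq j = lam.seq j ∧ i = mu.seq j}

/-- `V_0 = ⟨e_0, e_k, e_{-k} ∣ k ∈ col(d_0)⟩`; this is `⟨e_0⟩` if there is no `d_0`. -/
def Vzero {n : ℕ} (mu lam : SY n) : Submodule ℂ (V n) :=
  coordSpan n {i | i = 0 ∨ ∃ d : Component mu lam, (0 : ℤ) ∈ col d ∧ (i ∈ col d ∨ -i ∈ col d)}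

/-- The span of the `e_k` with `k ∈ col(d)`. -/
def Vd {n : ℕ} {mu lam : SY n} (d : Component mu lam) : Submodule ℂ (V n) :=
  coordSpan n (col d)

/-- The span of the `e_{-k}` with `k ∈ col(d)`. -/
def VdNeg {n : ℕ} {mu lam : SY n} (d : Component mu lam) : Submodule ℂ (V n) :=
  coordSpan n {i | -i ∈ col d}

/-- The part of `H` that belongs to a factor: `H_0 = H ∩ V_0`, and `H_d` is the sum of the
intersections of `H` with `⟨e_k ∣ k ∈ col(d)⟩` and with `⟨e_{-k} ∣ k ∈ col(d)⟩`. -/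
def part {n : ℕ} {mu lam : SY n} (H : Submodule ℂ (V n)) :
    FactorIdx mu lam → Submodule ℂ (V n)
  | none => H ⊓ Vzero mu lam
  | some d => (H ⊓ VdNeg d.1) ⊔ (H ⊓ Vd d.1)

/-- The factor `{H_0 ∣ H ∈ X_μ ∩ X'_{λ^c}}`, respectively `{H_d ∣ H ∈ X_μ ∩ X'_{λ^c}}`. -/
def factor {n : ℕ} (mu lam : SY n) (c : FactorIdx mu lam) : Set (Submodule ℂ (V n)) :=
  (fun H => part H c) '' (schubert mu ∩ schubertOpp lam)

/-! ## Regular maps between subvarieties of products of Grassmannians -/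

/-- A tuple of frames for a tuple of subspaces: `M i` is an ordered basis with `k i` elements of
the subspace `H i`. The entries of `M` are homogeneous coordinates of the point `H` of
`∏ i, Gr(k i, ι → ℂ)`. -/
def IsFrame {ι I : Type} {k : I → ℕ} (M : ∀ i, Fin (k i) → ι → ℂ)
    (H : I → Submodule ℂ (ι → ℂ)) : Prop :=
  ∀ i, LinearIndependent ℂ (M i) ∧ Submodule.span ℂ (Set.range (M i)) = H i

/-- The value at the frames `M` of a matrix `g` of polynomials in the entries of frames. -/
noncomputable def evalAt {ι I : Type} {k : I → ℕ} {l : ℕ}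
    (g : Fin l → ι → MvPolynomial (Σ i : I, Fin (k i) × ι) ℂ)
    (M : ∀ i, Fin (k i) → ι → ℂ) : Fin l → ι → ℂ :=
  fun r s => MvPolynomial.eval (fun v => M v.1 v.2.1 v.2.2) (g r s)

/-- Let `S` and `T` be realised, by `p` and `q`, as sets of points of the products of
Grassmannians `∏ i, Gr(k i, ι → ℂ)` and `∏ j, Gr(l j, ι → ℂ)`. The map `Φ : S → T` is regular if
near each point of `S` each component of `Φ` is given by polynomials in homogeneous coordinates:
there is a matrix `g` of polynomials in the entries of frames which at some frames of the given
point has linearly independent rows, and whose rows, at all frames of points `y` of `S` where they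
are linearly independent, form a frame of that component of `Φ y`. For lines, where a frame is a
nonzero vector, this is the usual definition of a regular map between subsets of projective
spaces. -/
structure IsRegularMap {ι I J S T : Type} (k : I → ℕ) (l : J → ℕ)
    (p : S → I → Submodule ℂ (ι → ℂ)) (q : T → J → Submodule ℂ (ι → ℂ)) (Φ : S → T) :
    Prop where
  source_dim : ∀ x i, Module.finrank ℂ (p x i) = k i
  target_dim : ∀ y j, Module.finrank ℂ (q y j) = l j
  source_injective : Function.Injective p
  target_injective : Function.Injective q
  local_polynomial : ∀ (x : S) (j : J),
    ∃ g : Fin (l j) → ι → MvPolynomial (Σ i : I, Fin (k i) × ι) ℂ,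
      (∃ M : ∀ i, Fin (k i) → ι → ℂ, IsFrame M (p x) ∧ LinearIndependent ℂ (evalAt g M)) ∧
      ∀ (y : S) (M : ∀ i, Fin (k i) → ι → ℂ), IsFrame M (p y) →
        LinearIndependent ℂ (evalAt g M) →
        Submodule.span ℂ (Set.range (evalAt g M)) = q (Φ y) j

/-! ## Identification of a factor with subspaces of a smaller quadratic space -/

/-- The shift `a - 1` of a factor, where `a` is its least positive column. -/
noncomputable def factorShift {n : ℕ} {mu lam : SY n} (c : FactorIdx mu lam) : ℤ :=
  sInf (factorCols c) - 1

/-- The isometric embedding `ℂ^(2p+1) → V`, `p = factorDim c`, with `e_0 ↦ e_0` and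
`e_i ↦ e_{i+a-1}`, `e_{-i} ↦ e_{-(i+a-1)}` for `1 ≤ i ≤ p`. -/
noncomputable def factorEmb {n : ℕ} {mu lam : SY n} (c : FactorIdx mu lam) :
    V (factorDim c) →ₗ[ℂ] V n :=
  Fintype.linearCombination ℂ
    (fun i : Idx (factorDim c) => e n ((i : ℤ) + Int.sign i * factorShift c))

/-- `nu'` is the sequence obtained from `nu` by keeping the entries whose absolute value is a column
of the factor, and subtracting `a - 1` from their absolute values. -/
def IsRestriction {n : ℕ} {mu lam : SY n} (c : FactorIdx mu lam) (nu : SY n)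
    (nu' : SY (factorDim c)) : Prop :=
  Set.range nu'.seq =
    (fun v : ℤ => v - Int.sign v * factorShift c) '' {v ∈ Set.range nu.seq | |v| ∈ factorCols c}

/-!
The Richardson variety `X_μ ∩ X'_{λ^c}` factors because every one of its points `H` splits at the
integers `c` where `μ` and `λ` have equally many entries `≥ c` (`IsCut`): the Schubert conditions
bound `dim H ∩ ⟨e_i ∣ i ≥ c⟩` and `dim H ∩ ⟨e_i ∣ i < c⟩` from below by numbers that add up to
`n = dim H`, so `H` is the direct sum of the two intersections, is stable under the coordinate
projections, and the dimension counts are exact (`IsCut.coordProj_mem`, `IsCut.isPiece_Ico`).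

For `c ≥ 1` the cuts are the columns of `λ/μ` without boxes
(`isCut_iff_not_meetsColumn`), and if `c` is a cut then so is `1 - c`, since the entries of
absolute value `< c` are `c - 1` in number for each sequence. Boxes in adjacent columns are always
connected (`reachable_of_col_succ`), so that the components of `λ/μ` are the maximal runs of
nonempty columns (`exists_boxCols_eq`). Hence the sets of indices that belong to the factors are
unions of intervals between cuts, they are disjoint, and outside them `μ` and `λ` have the same
entries.

`IsPiece mu lam S W` expresses the rank conditions on an isotropic subspace `W` supported on `S`
as lower bounds, for all thresholds, by the numbers of entries of `μ` and `λ` in `S`. The parts of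
a point `H` are pieces (`IsPiece.part_spec`); conversely lower bounds add up, so arbitrary pieces
can be combined (`isPiece_assemble`), and as dimensions are known, the two constructions are
inverse to each other. Thus the factors are exactly the sets of pieces (`mem_factor_iff`). Forward,
the isomorphism concatenates frames; backward, it applies coordinate projections to a frame and
selects rows; both are polynomial. Finally the conditions that define a piece are invariant under
the order-preserving embedding of indices `i ↦ i + sign i * (a - 1)`
(`isPiece_map_shiftEmb_iff`), which identifies a factor with a Richardson variety in
`ℂ^(2p+1)`; in a factor without `e_0` the point `1` is a cut of the smaller sequences, which
excludes a component along `e_0`.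
-/

/-! ### Coordinate subspaces -/

lemma mem_coordSpan {n : ℕ} {S : Set ℤ} {x : V n} :
    x ∈ coordSpan n S ↔ ∀ k : Idx n, (k : ℤ) ∉ S → x k = 0 := by
  constructor
  · intro hx
    induction hx using Submodule.span_induction with
    | mem y hy =>
      obtain ⟨i, hi, rfl⟩ := hy
      intro k hk
      have : (k : ℤ) ≠ i := fun h => hk (h ▸ hi)
      simp [e, this]
    | zero => intro k _; rfl
    | add y z _ _ hy hz => intro k hk; simp [hy k hk, hz k hk]
    | smul a y _ hy => intro k hk; simp [hy k hk]
  · intro h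
    have hx : x = ∑ k : Idx n, x k • e n k := by
      ext m
      rw [Finset.sum_apply, Finset.sum_eq_single m]
      · simp [e]
      · intro b _ hb
        have : (m : ℤ) ≠ b := fun h => hb (Subtype.ext h.symm)
        simp [e, this]
      · simp
    rw [hx]
    refine Submodule.sum_mem _ fun k _ => ?_
    by_cases hk : (k : ℤ) ∈ S
    · exact Submodule.smul_mem _ _ (Submodule.subset_span ⟨_, hk, rfl⟩)
    · simp [h k hk]

lemma coordSpan_mono {n : ℕ} {S T : Set ℤ} (h : S ⊆ T) : coordSpan n S ≤ coordSpan n T :=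
  Submodule.span_mono (Set.image_mono h)

lemma coordSpan_univ (n : ℕ) : coordSpan n Set.univ = ⊤ :=
  eq_top_iff.2 fun _ _ => mem_coordSpan.2 fun _ h => absurd (Set.mem_univ _) h

lemma coordSpan_inf (n : ℕ) (S T : Set ℤ) :
    coordSpan n S ⊓ coordSpan n T = coordSpan n (S ∩ T) := by
  ext x
  simp only [Submodule.mem_inf, mem_coordSpan, Set.mem_inter_iff, not_and_or]
  exact ⟨fun h k hk => hk.elim (h.1 k) (h.2 k), fun h => ⟨fun k hk => h k (.inl hk),
    fun k hk => h k (.inr hk)⟩⟩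

lemma coordSpan_congr {n : ℕ} {S T : Set ℤ} (h : ∀ k ∈ Set.Icc (-(n : ℤ)) n, k ∈ S ↔ k ∈ T) :
    coordSpan n S = coordSpan n T := by
  ext x
  simp only [mem_coordSpan]
  exact forall_congr' fun k => by rw [h k (Set.mem_Icc.2 (Finset.mem_Icc.1 k.2))]

lemma disjoint_coordSpan {n : ℕ} {S T : Set ℤ} (h : Disjoint S T) :
    Disjoint (coordSpan n S) (coordSpan n T) := by
  rw [disjoint_iff, coordSpan_inf, h.inter_eq]
  simp [coordSpan]

open Classical in
/-- The coordinate projection of `V` onto the span of the `e_i` with `i ∈ S`. -/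
noncomputable def coordProj (n : ℕ) (S : Set ℤ) : V n →ₗ[ℂ] V n :=
  LinearMap.pi fun k => if (k : ℤ) ∈ S then LinearMap.proj k else 0

open Classical in
lemma coordProj_apply {n : ℕ} (S : Set ℤ) (x : V n) (k : Idx n) :
    coordProj n S x k = if (k : ℤ) ∈ S then x k else 0 := by
  simp only [coordProj, LinearMap.pi_apply]
  split_ifs <;> simp

lemma coordProj_mem {n : ℕ} (S : Set ℤ) (x : V n) : coordProj n S x ∈ coordSpan n S :=
  mem_coordSpan.2 fun k hk => by simp [coordProj_apply, hk]

lemma coordProj_eq_self {n : ℕ} {S : Set ℤ} {x : V n} (hx : x ∈ coordSpan n S) :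
    coordProj n S x = x := by
  ext k
  rw [coordProj_apply]
  split_ifs with h
  · rfl
  · exact (mem_coordSpan.1 hx k h).symm

lemma coordProj_eq_zero {n : ℕ} {S T : Set ℤ} (h : Disjoint S T) {x : V n}
    (hx : x ∈ coordSpan n T) : coordProj n S x = 0 := by
  ext k
  rw [coordProj_apply]
  split_ifs with hk
  · exact mem_coordSpan.1 hx k (Set.disjoint_left.1 h hk)
  · rfl

lemma coordProj_add_of_disjoint {n : ℕ} {S T : Set ℤ} (h : Disjoint S T) (x : V n) :
    coordProj n (S ∪ T) x = coordProj n S x + coordProj n T x := by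
  ext k
  simp only [coordProj_apply, Pi.add_apply, Set.mem_union]
  by_cases h1 : (k : ℤ) ∈ S
  · rw [if_pos (Set.mem_union_left _ h1), if_pos h1, if_neg (Set.disjoint_left.1 h h1), add_zero]
  · by_cases h2 : (k : ℤ) ∈ T
    · rw [if_pos (Set.mem_union_right _ h2), if_neg h1, if_pos h2, zero_add]
    · rw [if_neg (by rintro (h | h) <;> contradiction), if_neg h1, if_neg h2, zero_add]

lemma coordProj_sdiff {n : ℕ} {S T : Set ℤ} (h : S ⊆ T) (x : V n) :
    coordProj n (T \ S) x = coordProj n T x - coordProj n S x := by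
  ext k
  simp only [coordProj_apply, Pi.sub_apply]
  by_cases h1 : (k : ℤ) ∈ S
  · rw [if_neg fun h2 => h2.2 h1, if_pos h1, if_pos (h h1), sub_self]
  · by_cases h2 : (k : ℤ) ∈ T
    · rw [if_pos ⟨h2, h1⟩, if_neg h1, if_pos h2, sub_zero]
    · rw [if_neg fun h => h2 h.1, if_neg h1, if_neg h2, sub_zero]

lemma finrank_sup_eq_add {n : ℕ} {A B : Submodule ℂ (V n)} (h : Disjoint A B) :
    Module.finrank ℂ ↥(A ⊔ B) = Module.finrank ℂ A + Module.finrank ℂ B := by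
  have := Submodule.finrank_sup_add_finrank_inf_eq A B
  rw [h.eq_bot, finrank_bot] at this
  simpa using this

/-- Intersections of a subspace with complementary coordinate subspaces are independent. -/
lemma finrank_inf_add_finrank_inf_le {n : ℕ} {S T : Set ℤ} (h : Disjoint S T)
    (W : Submodule ℂ (V n)) :
    Module.finrank ℂ ↥(W ⊓ coordSpan n S) + Module.finrank ℂ ↥(W ⊓ coordSpan n T) ≤
      Module.finrank ℂ W := by
  rw [← finrank_sup_eq_add ((disjoint_coordSpan h).mono inf_le_right inf_le_right)]
  exact Submodule.finrank_mono (sup_le inf_le_left inf_le_left)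

/-- If the intersections of `W` with complementary coordinate subspaces are large enough to
fill `W`, then `W` is stable under the coordinate projections. -/
lemma coordProj_mem_of_finrank_le {n : ℕ} {S T : Set ℤ} (h : Disjoint S T)
    {W : Submodule ℂ (V n)}
    (hW : Module.finrank ℂ W ≤
      Module.finrank ℂ ↥(W ⊓ coordSpan n S) + Module.finrank ℂ ↥(W ⊓ coordSpan n T))
    {x : V n} (hx : x ∈ W) : coordProj n S x ∈ W := by
  have hd := (disjoint_coordSpan (n := n) h).mono (inf_le_right (a := W)) (inf_le_right (a := W))
  have heq : W ⊓ coordSpan n S ⊔ W ⊓ coordSpan n T = W :=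
    Submodule.eq_of_le_of_finrank_le (sup_le inf_le_left inf_le_left)
      (by rwa [finrank_sup_eq_add hd])
  rw [← heq] at hx
  obtain ⟨u, hu, v, hv, rfl⟩ := Submodule.mem_sup.1 hx
  rw [map_add, coordProj_eq_self hu.2, coordProj_eq_zero h hv.2, add_zero]
  exact hu.1

lemma inf_coordSpan_union {n : ℕ} {S T : Set ℤ} (h : Disjoint S T)
    {W : Submodule ℂ (V n)} (hS : ∀ x ∈ W, coordProj n S x ∈ W) :
    W ⊓ coordSpan n (S ∪ T) = W ⊓ coordSpan n S ⊔ W ⊓ coordSpan n T := by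
  refine le_antisymm ?_ (sup_le (inf_le_inf_left _ (coordSpan_mono Set.subset_union_left))
    (inf_le_inf_left _ (coordSpan_mono Set.subset_union_right)))
  rintro x ⟨hx, hx'⟩
  have h1 := coordProj_eq_self hx'
  rw [coordProj_add_of_disjoint h] at h1
  refine Submodule.mem_sup.2 ⟨_, ⟨hS x hx, coordProj_mem _ _⟩, _, ⟨?_, coordProj_mem _ _⟩, h1⟩
  rw [← eq_sub_iff_add_eq'] at h1
  rw [h1]
  exact W.sub_mem hx (hS x hx)

lemma finrank_inf_coordSpan_union {n : ℕ} {S T : Set ℤ} (h : Disjoint S T)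
    {W : Submodule ℂ (V n)} (hS : ∀ x ∈ W, coordProj n S x ∈ W) :
    Module.finrank ℂ ↥(W ⊓ coordSpan n (S ∪ T)) =
      Module.finrank ℂ ↥(W ⊓ coordSpan n S) + Module.finrank ℂ ↥(W ⊓ coordSpan n T) := by
  rw [inf_coordSpan_union h hS,
    finrank_sup_eq_add ((disjoint_coordSpan h).mono inf_le_right inf_le_right)]

lemma linearIndependent_e {n : ℕ} : LinearIndependent ℂ (fun k : Idx n => e n k) := by
  have : (fun k : Idx n => e n k) = Pi.basisFun ℂ (Idx n) := by
    ext k m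
    rw [Pi.basisFun_apply, Pi.single_apply]
    exact if_congr Subtype.ext_iff.symm rfl rfl
  rw [this]
  exact (Pi.basisFun ℂ (Idx n)).linearIndependent

lemma finrank_coordSpan {n : ℕ} {S : Set ℤ} (hS : S ⊆ Set.Icc (-(n : ℤ)) n) :
    Module.finrank ℂ ↥(coordSpan n S) = S.ncard := by
  have hfin : S.Finite := (Set.finite_Icc _ _).subset hS
  have := hfin.fintype
  have hli : LinearIndependent ℂ (fun k : S => e n k) :=
    linearIndependent_e.comp (fun k : S => (⟨k, Finset.mem_Icc.2 (Set.mem_Icc.1 (hS k.2))⟩ : Idx n))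
      (fun a b hab => Subtype.ext (congrArg (fun t : Idx n => (t : ℤ)) hab))
  have := finrank_span_eq_card hli
  rw [coordSpan, Set.image_eq_range, this, ← Nat.card_eq_fintype_card, Nat.card_coe_set_eq]

/-! ### The bilinear form in coordinates -/

lemma beta_apply {n : ℕ} (x y : V n) :
    beta n x y = ∑ i : Idx n, ∑ j : Idx n, if (i : ℤ) = -(j : ℤ) then x i * y j else 0 := by
  rw [beta, Matrix.toBilin'_apply]
  refine Finset.sum_congr rfl fun i _ => Finset.sum_congr rfl fun j _ => ?_
  simp only [Matrix.of_apply]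
  split_ifs <;> simp

lemma beta_comm {n : ℕ} (x y : V n) : beta n x y = beta n y x := by
  rw [beta_apply, beta_apply, Finset.sum_comm]
  refine Finset.sum_congr rfl fun i _ => Finset.sum_congr rfl fun j _ => ?_
  have : (j : ℤ) = -(i : ℤ) ↔ (i : ℤ) = -(j : ℤ) := by omega
  simp only [this, mul_comm]

lemma beta_eq_zero {n : ℕ} {S T : Set ℤ} (h : ∀ i ∈ S, -i ∉ T) {x y : V n}
    (hx : x ∈ coordSpan n S) (hy : y ∈ coordSpan n T) : beta n x y = 0 := by
  rw [beta_apply]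
  refine Finset.sum_eq_zero fun i _ => Finset.sum_eq_zero fun j _ => ?_
  split_ifs with hij
  · by_cases hi : (i : ℤ) ∈ S
    · have : (j : ℤ) ∉ T := by
        have := h i hi
        rwa [hij, neg_neg] at this
      rw [mem_coordSpan.1 hy j this, mul_zero]
    · rw [mem_coordSpan.1 hx i hi, zero_mul]
  · rfl

lemma beta_e_right {n : ℕ} (x : V n) (i j : Idx n) (h : (i : ℤ) = -(j : ℤ)) :
    beta n x (e n j) = x i := by
  rw [beta_apply, Finset.sum_eq_single i, Finset.sum_eq_single j]
  · simp [h, e]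
  · intro b _ hb
    have : (b : ℤ) ≠ j := fun h => hb (Subtype.ext h)
    simp [e, this]
  · simp
  · intro b _ hb
    refine Finset.sum_eq_zero fun k _ => ?_
    split_ifs with hbk
    · have : (k : ℤ) ≠ j := fun hk => hb (Subtype.ext (by omega))
      simp [e, this]
    · rfl
  · simp

/-! ### Counting the entries of a signed sequence -/

/-- The number of entries of the sequence `mu` that lie in `S`. -/
noncomputable def entryCount {n : ℕ} (mu : SY n) (S : Set ℤ) : ℕ := (Set.range mu.seq ∩ S).ncard

section entryCount

variable {n : ℕ} (mu : SY n)

lemma SY.abs_mem (j : Fin n) : |mu.seq j| ∈ Set.Icc (1 : ℤ) n := by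
  rw [← mu.range_abs]
  exact ⟨j, rfl⟩

lemma SY.mem_Icc (j : Fin n) : mu.seq j ∈ Set.Icc (-(n : ℤ)) n :=
  abs_le.1 (mu.abs_mem j).2

lemma SY.abs_injective : Function.Injective fun j => |mu.seq j| := by
  classical
  rw [← Set.injOn_univ, ← Finset.coe_univ, ← Finset.card_image_iff]
  have : (Finset.univ.image fun j => |mu.seq j|) = Finset.Icc (1 : ℤ) n := by
    ext k
    have := Set.ext_iff.1 mu.range_abs k
    simpa using this
  rw [this]
  simp

lemma SY.finite_range_inter (S : Set ℤ) : (Set.range mu.seq ∩ S).Finite :=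
  (Set.finite_range _).inter_of_left _

lemma entryCount_eq_preimage (S : Set ℤ) : entryCount mu S = (mu.seq ⁻¹' S).ncard := by
  rw [entryCount, Set.inter_comm, ← Set.image_preimage_eq_inter_range,
    Set.ncard_image_of_injective _ mu.strictAnti.injective]

lemma entryCount_univ : entryCount mu Set.univ = n := by
  rw [entryCount_eq_preimage]
  simp

lemma entryCount_union {S T : Set ℤ} (h : Disjoint S T) :
    entryCount mu (S ∪ T) = entryCount mu S + entryCount mu T := by
  rw [entryCount, Set.inter_union_distrib_left, Set.ncard_union_eq
    (h.mono Set.inter_subset_right Set.inter_subset_right)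
    (mu.finite_range_inter S) (mu.finite_range_inter T)]
  rfl

lemma entryCount_mono {S T : Set ℤ} (h : S ⊆ T) : entryCount mu S ≤ entryCount mu T :=
  Set.ncard_le_ncard (Set.inter_subset_inter_right _ h) (mu.finite_range_inter T)

lemma entryCount_empty : entryCount mu ∅ = 0 := by simp [entryCount]

lemma entryCount_Iic_add_Ici (t : ℤ) :
    entryCount mu (Set.Iic (t - 1)) + entryCount mu (Set.Ici t) = n := by
  rw [← entryCount_union]
  · refine (congrArg _ ?_).trans (entryCount_univ mu)
    ext i
    simp only [Set.mem_union, Set.mem_Iic, Set.mem_Ici, Set.mem_univ, iff_true]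
    omega
  · rw [Set.disjoint_left]
    intro i h1 h2
    simp only [Set.mem_Iic, Set.mem_Ici] at h1 h2
    omega

lemma entryCount_Ico_add_Ici {a b : ℤ} (h : a ≤ b) :
    entryCount mu (Set.Ico a b) + entryCount mu (Set.Ici b) = entryCount mu (Set.Ici a) := by
  rw [← entryCount_union, Set.Ico_union_Ici_eq_Ici h]
  rw [Set.disjoint_left]
  intro i h1 h2
  simp only [Set.mem_Ico, Set.mem_Ici] at h1 h2
  omega

/-- The entries of `mu` decrease, so those that are at least `t` are the first ones. -/
lemma lt_entryCount_Ici_iff (t : ℤ) (j : Fin n) :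
    (j : ℕ) < entryCount mu (Set.Ici t) ↔ t ≤ mu.seq j := by
  rw [entryCount_eq_preimage]
  constructor
  · intro h
    by_contra! hlt
    have hsub : mu.seq ⁻¹' Set.Ici t ⊆ Set.Iio j := by
      intro i hi
      by_contra hij
      have := mu.strictAnti.antitone (not_lt.1 hij)
      exact absurd hi (not_le.2 (this.trans_lt hlt))
    have := Set.ncard_le_ncard hsub (Set.toFinite _)
    rw [← Finset.coe_Iio, Set.ncard_coe_finset, Fin.card_Iio] at this
    omega
  · intro h
    have hsub : Set.Iic j ⊆ mu.seq ⁻¹' Set.Ici t := fun i hi =>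
      h.trans (mu.strictAnti.antitone hi)
    have := Set.ncard_le_ncard hsub (Set.toFinite _)
    rw [← Finset.coe_Iic, Set.ncard_coe_finset, Fin.card_Iic] at this
    omega

lemma sub_le_entryCount_Iic_iff (t : ℤ) (j : Fin n) :
    n - (j : ℕ) ≤ entryCount mu (Set.Iic t) ↔ mu.seq j ≤ t := by
  have h1 := lt_entryCount_Ici_iff mu (t + 1) j
  have h2 := entryCount_Iic_add_Ici mu (t + 1)
  rw [add_sub_cancel_right] at h2
  have := j.2
  omega

/-- Every absolute value between `1` and `n` is that of exactly one entry. -/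
lemma entryCount_abs_preimage (C : Set ℤ) (hC : C ⊆ Set.Icc 1 (n : ℤ)) :
    entryCount mu {i | |i| ∈ C} = C.ncard := by
  rw [entryCount_eq_preimage]
  have : (fun j => |mu.seq j|) '' (mu.seq ⁻¹' {i | |i| ∈ C}) = C := by
    ext k
    constructor
    · rintro ⟨j, hj, rfl⟩
      exact hj
    · intro hk
      have := hC hk
      rw [← mu.range_abs] at this
      obtain ⟨j, rfl⟩ := this
      exact ⟨j, hk, rfl⟩
  rw [← Set.ncard_image_of_injective _ mu.abs_injective, this]

/-- The entries of absolute value less than `c` are `c - 1` in number, whatever their signs. -/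
lemma entryCount_Ici_one_sub {c : ℤ} (h1 : 1 ≤ c) (h2 : c ≤ n + 1) :
    (entryCount mu (Set.Ici (1 - c)) : ℤ) = c - 1 + entryCount mu (Set.Ici c) := by
  have h := entryCount_abs_preimage mu (Set.Ico 1 c) (fun i hi => by
    simp only [Set.mem_Ico, Set.mem_Icc] at hi ⊢; omega)
  have h3 : entryCount mu {i | |i| ∈ Set.Ico 1 c} = entryCount mu (Set.Ico (1 - c) c) := by
    rw [entryCount, entryCount]
    congr 1
    ext i
    simp only [Set.mem_inter_iff, Set.mem_ofPred_eq, Set.mem_Ico]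
    refine and_congr_right ?_
    rintro ⟨j, rfl⟩
    have := (mu.abs_mem j).1
    constructor
    · rintro ⟨-, h⟩
      have := abs_lt.1 h
      omega
    · intro h
      exact ⟨this, abs_lt.2 (by omega)⟩
  have h4 := entryCount_Ico_add_Ici mu (show 1 - c ≤ c by omega)
  have h5 : (Set.Ico 1 c).ncard = (c - 1).toNat := by
    rw [← Finset.coe_Ico, Set.ncard_coe_finset, Int.card_Ico]
  omega

end entryCount

/-! ### Pieces of the Richardson variety -/

/-- `W` is an isotropic subspace supported on the indices in `S`, of the dimension and with the
rank conditions that the entries of `mu` and `lam` in `S` prescribe. For `S = univ` these are the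
points of `X_μ ∩ X'_{λ^c}`; for the other `S` below, the possible `H ∩ ⟨e_i ∣ i ∈ S⟩`. -/
structure IsPiece {n : ℕ} (mu lam : SY n) (S : Set ℤ) (W : Submodule ℂ (V n)) : Prop where
  le_coordSpan : W ≤ coordSpan n S
  isotropic : ∀ x ∈ W, ∀ y ∈ W, beta n x y = 0
  finrank_eq : Module.finrank ℂ W = entryCount mu S
  le_finrank_Ici : ∀ t : ℤ,
    entryCount mu (S ∩ Set.Ici t) ≤ Module.finrank ℂ ↥(W ⊓ coordSpan n (Set.Ici t))
  le_finrank_Iic : ∀ t : ℤ,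
    entryCount lam (S ∩ Set.Iic t) ≤ Module.finrank ℂ ↥(W ⊓ coordSpan n (Set.Iic t))

lemma coordSpan_Icc_right (n : ℕ) (t : ℤ) :
    coordSpan n (Set.Icc t n) = coordSpan n (Set.Ici t) :=
  coordSpan_congr fun k hk => by
    simp only [Set.mem_Icc, Set.mem_Ici] at hk ⊢
    omega

lemma coordSpan_Icc_left (n : ℕ) (t : ℤ) :
    coordSpan n (Set.Icc (-(n : ℤ)) t) = coordSpan n (Set.Iic t) :=
  coordSpan_congr fun k hk => by
    simp only [Set.mem_Icc, Set.mem_Iic] at hk ⊢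
    omega

lemma mem_richardson_iff {n : ℕ} {mu lam : SY n} {H : Submodule ℂ (V n)} :
    H ∈ schubert mu ∩ schubertOpp lam ↔ IsPiece mu lam Set.univ H := by
  constructor
  · rintro ⟨⟨⟨hiso, hdim⟩, h1⟩, -, h2⟩
    refine ⟨by simp [coordSpan_univ], hiso, by rw [hdim, entryCount_univ], fun t => ?_,
      fun t => ?_⟩
    · rw [Set.univ_inter]
      by_contra! hlt
      have hn := entryCount_mono mu (Set.subset_univ (Set.Ici t))
      rw [entryCount_univ] at hn
      set r := Module.finrank ℂ ↥(H ⊓ coordSpan n (Set.Ici t)) with hr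
      have h3 := h1 ⟨r, by omega⟩
      rw [coordSpan_Icc_right] at h3
      have hle := Submodule.finrank_mono (inf_le_inf_left H (coordSpan_mono (n := n)
        (Set.Ici_subset_Ici.2 ((lt_entryCount_Ici_iff mu t ⟨r, by omega⟩).1 hlt))))
      have := h3.trans hle
      simp only at this
      omega
    · rw [Set.univ_inter]
      by_contra! hlt
      have hn := entryCount_mono lam (Set.subset_univ (Set.Iic t))
      rw [entryCount_univ] at hn
      set r := Module.finrank ℂ ↥(H ⊓ coordSpan n (Set.Iic t)) with hr
      have h3 := h2 ⟨n - (r + 1), by omega⟩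
      rw [coordSpan_Icc_left] at h3
      have hle := Submodule.finrank_mono (inf_le_inf_left H (coordSpan_mono (n := n)
        (Set.Iic_subset_Iic.2 ((sub_le_entryCount_Iic_iff lam t ⟨n - (r + 1), by omega⟩).1
          (by simp only; omega)))))
      have := h3.trans hle
      simp only at this
      omega
  · rintro ⟨-, hiso, hdim, h1, h2⟩
    rw [entryCount_univ] at hdim
    refine ⟨⟨⟨hiso, hdim⟩, fun j => ?_⟩, ⟨hiso, hdim⟩, fun j => ?_⟩
    · rw [coordSpan_Icc_right]
      have := h1 (mu.seq j)
      rw [Set.univ_inter] at this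
      exact le_trans ((lt_entryCount_Ici_iff mu _ j).2 le_rfl) this
    · rw [coordSpan_Icc_left]
      have := h2 (lam.seq j)
      rw [Set.univ_inter] at this
      exact le_trans ((sub_le_entryCount_Iic_iff lam _ j).2 le_rfl) this

namespace IsPiece

variable {n : ℕ} {mu lam : SY n}

/-- All rank conditions are lower bounds, so they add up over orthogonal pieces with disjoint
supports. -/
lemma sup {S T : Set ℤ} {W U : Submodule ℂ (V n)} (hW : IsPiece mu lam S W)
    (hU : IsPiece mu lam T U) (hST : Disjoint S T) (horth : ∀ x ∈ W, ∀ y ∈ U, beta n x y = 0) :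
    IsPiece mu lam (S ∪ T) (W ⊔ U) := by
  have hd : Disjoint W U := (disjoint_coordSpan hST).mono hW.le_coordSpan hU.le_coordSpan
  have key : ∀ (nu : SY n) (R : Set ℤ),
      entryCount nu (S ∩ R) ≤ Module.finrank ℂ ↥(W ⊓ coordSpan n R) →
      entryCount nu (T ∩ R) ≤ Module.finrank ℂ ↥(U ⊓ coordSpan n R) →
      entryCount nu ((S ∪ T) ∩ R) ≤ Module.finrank ℂ ↥((W ⊔ U) ⊓ coordSpan n R) := by
    intro nu R h1 h2
    rw [Set.union_inter_distrib_right,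
      entryCount_union _ (hST.mono Set.inter_subset_left Set.inter_subset_left)]
    refine (add_le_add h1 h2).trans ?_
    rw [← finrank_sup_eq_add (hd.mono inf_le_left inf_le_left)]
    exact Submodule.finrank_mono (sup_le (inf_le_inf_right _ le_sup_left)
      (inf_le_inf_right _ le_sup_right))
  refine ⟨sup_le (hW.le_coordSpan.trans (coordSpan_mono Set.subset_union_left))
    (hU.le_coordSpan.trans (coordSpan_mono Set.subset_union_right)), ?_, ?_,
    fun t => key _ _ (hW.le_finrank_Ici t) (hU.le_finrank_Ici t),
    fun t => key _ _ (hW.le_finrank_Iic t) (hU.le_finrank_Iic t)⟩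
  · intro x hx y hy
    obtain ⟨a, ha, b, hb, rfl⟩ := Submodule.mem_sup.1 hx
    obtain ⟨c, hc, d, hd, rfl⟩ := Submodule.mem_sup.1 hy
    rw [map_add, map_add, LinearMap.add_apply, LinearMap.add_apply, hW.isotropic a ha c hc,
      hU.isotropic b hb d hd, horth a ha d hd, beta_comm b c, horth c hc b hb]
    simp
  · rw [finrank_sup_eq_add hd, hW.finrank_eq, hU.finrank_eq, entryCount_union _ hST]

lemma iSup {I : Type*} (s : Finset I) {S : I → Set ℤ} {W : I → Submodule ℂ (V n)}
    {T : Set ℤ} {U : Submodule ℂ (V n)} (hU : IsPiece mu lam T U)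
    (hW : ∀ i, IsPiece mu lam (S i) (W i)) (hT : ∀ i, Disjoint T (S i))
    (hS : Pairwise fun i j => Disjoint (S i) (S j)) (hneg : ∀ i, ∀ k ∈ S i, -k ∈ S i) :
    IsPiece mu lam (T ∪ ⋃ i ∈ s, S i) (U ⊔ ⨆ i ∈ s, W i) := by
  classical
  induction s using Finset.induction_on with
  | empty => simpa using hU
  | insert i s hi ih =>
    rw [Finset.set_biUnion_insert, Finset.iSup_insert, Set.union_comm (S i), ← Set.union_assoc,
      sup_comm (W i), ← sup_assoc]
    have hdis : Disjoint (T ∪ ⋃ j ∈ s, S j) (S i) := by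
      rw [Set.disjoint_union_left]
      refine ⟨hT i, ?_⟩
      simp only [Set.disjoint_iUnion_left]
      exact fun j hj => hS fun h => hi (h ▸ hj)
    refine ih.sup (hW i) hdis fun x hx y hy => ?_
    refine beta_eq_zero (fun k hk hk' => Set.disjoint_left.1 hdis hk ?_) (ih.le_coordSpan hx)
      ((hW i).le_coordSpan hy)
    have := hneg i _ hk'
    rwa [neg_neg] at this

end IsPiece

/-- As many entries of `mu` as of `lam` are at least `c`; for `μ ≤ λ` this says that no interval
`(μ_j, λ_j]` contains `c`. At such `c` every `H` in `X_μ ∩ X'_{λ^c}` splits. -/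
def IsCut {n : ℕ} (mu lam : SY n) (c : ℤ) : Prop :=
  entryCount mu (Set.Ici c) = entryCount lam (Set.Ici c)

section IsCut

variable {n : ℕ} {mu lam : SY n}

lemma IsCut.one_sub {c : ℤ} (h : IsCut mu lam c) (h1 : 1 ≤ c) (h2 : c ≤ n + 1) :
    IsCut mu lam (1 - c) := by
  have h3 := entryCount_Ici_one_sub mu h1 h2
  have h4 := entryCount_Ici_one_sub lam h1 h2
  unfold IsCut at *
  omega

lemma disjoint_Iic_Ici {a : ℤ} : Disjoint (Set.Iic (a - 1)) (Set.Ici a) := by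
  rw [Set.disjoint_left]
  intro i h1 h2
  simp only [Set.mem_Iic, Set.mem_Ici] at h1 h2
  omega

variable {H : Submodule ℂ (V n)}

lemma IsCut.finrank_add (hH : IsPiece mu lam Set.univ H) {a : ℤ} (ha : IsCut mu lam a) :
    Module.finrank ℂ ↥(H ⊓ coordSpan n (Set.Ici a)) = entryCount mu (Set.Ici a) ∧
      Module.finrank ℂ ↥(H ⊓ coordSpan n (Set.Iic (a - 1))) =
        entryCount lam (Set.Iic (a - 1)) := by
  have h1 := hH.le_finrank_Ici a
  have h2 := hH.le_finrank_Iic (a - 1)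
  have h3 := finrank_inf_add_finrank_inf_le (n := n) (disjoint_Iic_Ici (a := a)) H
  have h4 := entryCount_Iic_add_Ici lam a
  rw [Set.univ_inter] at h1 h2
  rw [hH.finrank_eq, entryCount_univ] at h3
  unfold IsCut at ha
  omega

lemma IsCut.coordProj_mem (hH : IsPiece mu lam Set.univ H) {a : ℤ}
    (ha : IsCut mu lam a) {x : V n} (hx : x ∈ H) :
    coordProj n (Set.Ici a) x ∈ H := by
  obtain ⟨h1, h2⟩ := ha.finrank_add hH
  have h4 := entryCount_Iic_add_Ici lam a
  refine coordProj_mem_of_finrank_le disjoint_Iic_Ici.symm ?_ hx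
  rw [hH.finrank_eq, entryCount_univ]
  unfold IsCut at ha
  omega

lemma IsCut.coordProj_Ico_mem (hH : IsPiece mu lam Set.univ H) {a b : ℤ}
    (ha : IsCut mu lam a) (hb : IsCut mu lam b) (hab : a ≤ b) {x : V n} (hx : x ∈ H) :
    coordProj n (Set.Ico a b) x ∈ H := by
  have : Set.Ico a b = Set.Ici a \ Set.Ici b := by
    ext i
    simp
  rw [this, coordProj_sdiff (Set.Ici_subset_Ici.2 hab)]
  exact H.sub_mem (ha.coordProj_mem hH hx) (hb.coordProj_mem hH hx)

lemma IsCut.coordProj_Iic_mem (hH : IsPiece mu lam Set.univ H) {a : ℤ}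
    (ha : IsCut mu lam a) {x : V n} (hx : x ∈ H) :
    coordProj n (Set.Iic (a - 1)) x ∈ H := by
  have : Set.Iic (a - 1) = Set.univ \ Set.Ici a := by
    ext i
    simp only [Set.mem_Iic, Set.mem_sdiff, Set.mem_univ, Set.mem_Ici, true_and]
    omega
  rw [this, coordProj_sdiff (Set.subset_univ _),
    coordProj_eq_self (S := Set.univ) (by simp [coordSpan_univ])]
  exact H.sub_mem hx (ha.coordProj_mem hH hx)

/-- Between two cuts, the dimension counts at the two ends are exact, so that the rank
conditions on `H` become rank conditions on its part between the cuts. -/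
lemma IsCut.isPiece_Ico (hH : IsPiece mu lam Set.univ H) {a b : ℤ}
    (ha : IsCut mu lam a) (hb : IsCut mu lam b) (hab : a ≤ b) :
    IsPiece mu lam (Set.Ico a b) (H ⊓ coordSpan n (Set.Ico a b)) := by
  have hupper : ∀ t ≤ b, Module.finrank ℂ ↥(H ⊓ coordSpan n (Set.Ici t)) =
      Module.finrank ℂ ↥(H ⊓ coordSpan n (Set.Ico t b)) + entryCount mu (Set.Ici b) := by
    intro t ht
    rw [← (hb.finrank_add hH).1, ← Set.Ico_union_Ici_eq_Ici ht, Set.union_comm,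
      finrank_inf_coordSpan_union _ fun x => hb.coordProj_mem hH, add_comm]
    rw [Set.disjoint_left]
    exact fun i h1 h2 => not_lt.2 h1 h2.2
  have hlower : ∀ t, a - 1 ≤ t → Module.finrank ℂ ↥(H ⊓ coordSpan n (Set.Iic t)) =
      Module.finrank ℂ ↥(H ⊓ coordSpan n (Set.Ico a (t + 1))) +
        entryCount lam (Set.Iic (a - 1)) := by
    intro t ht
    have : Set.Iic t = Set.Iic (a - 1) ∪ Set.Ico a (t + 1) := by
      ext i
      simp only [Set.mem_Iic, Set.mem_union, Set.mem_Ico]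
      omega
    rw [← (ha.finrank_add hH).2, this,
      finrank_inf_coordSpan_union _ fun x => ha.coordProj_Iic_mem hH, add_comm]
    exact disjoint_Iic_Ici.mono_right Set.Ico_subset_Ici_self
  refine ⟨inf_le_right, fun x hx y hy => hH.isotropic x hx.1 y hy.1, ?_, fun t => ?_,
    fun t => ?_⟩
  · have h1 := hupper a hab
    have h2 := entryCount_Ico_add_Ici mu hab
    have h3 := (ha.finrank_add hH).1
    omega
  · rw [inf_assoc, coordSpan_inf]
    rcases le_or_gt b t with hbt | hbt
    · have : Set.Ico a b ∩ Set.Ici t = ∅ := by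
        refine Set.eq_empty_of_forall_notMem fun i hi => ?_
        simp only [Set.mem_inter_iff, Set.mem_Ico, Set.mem_Ici] at hi
        omega
      rw [this, entryCount_empty]
      exact Nat.zero_le _
    · have : Set.Ico a b ∩ Set.Ici t = Set.Ico (max a t) b := by
        ext i
        simp only [Set.mem_inter_iff, Set.mem_Ico, Set.mem_Ici]
        omega
      rw [this]
      have h1 := hupper (max a t) (by omega)
      have h2 := entryCount_Ico_add_Ici mu (show max a t ≤ b by omega)
      have h3 := hH.le_finrank_Ici (max a t)
      rw [Set.univ_inter] at h3
      omega
  · rw [inf_assoc, coordSpan_inf]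
    rcases lt_or_ge t a with hta | hta
    · have : Set.Ico a b ∩ Set.Iic t = ∅ := by
        refine Set.eq_empty_of_forall_notMem fun i hi => ?_
        simp only [Set.mem_inter_iff, Set.mem_Ico, Set.mem_Iic] at hi
        omega
      rw [this, entryCount_empty]
      exact Nat.zero_le _
    · have : Set.Ico a b ∩ Set.Iic t = Set.Ico a (min (b - 1) t + 1) := by
        ext i
        simp only [Set.mem_inter_iff, Set.mem_Ico, Set.mem_Iic]
        omega
      rw [this]
      have h1 := hlower (min (b - 1) t) (by omega)
      have h2 := entryCount_Ico_add_Ici lam (show a ≤ min (b - 1) t + 1 by omega)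
      have h3 := hH.le_finrank_Iic (min (b - 1) t)
      have h4 := entryCount_Iic_add_Ici lam a
      have h5 := entryCount_Iic_add_Ici lam (min (b - 1) t + 1)
      rw [Set.univ_inter] at h3
      rw [add_sub_cancel_right] at h5
      omega

lemma isPiece_symm_Ico (hH : IsPiece mu lam Set.univ H) {p q : ℤ}
    (hp : IsCut mu lam p) (hq : IsCut mu lam q) (h1 : 1 ≤ p)
    (hpq : p ≤ q) (hqn : q ≤ n + 1) :
    IsPiece mu lam {i | |i| ∈ Set.Ico p q} (H ⊓ coordSpan n {i | |i| ∈ Set.Ico p q}) ∧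
    H ⊓ coordSpan n {i | |i| ∈ Set.Ico p q} =
      (H ⊓ coordSpan n {i | -i ∈ Set.Ico p q}) ⊔ (H ⊓ coordSpan n (Set.Ico p q)) ∧
    ∀ x ∈ H, coordProj n {i | |i| ∈ Set.Ico p q} x ∈ H := by
  have hS : {i | |i| ∈ Set.Ico p q} = {i : ℤ | -i ∈ Set.Ico p q} ∪ Set.Ico p q := by
    ext i
    simp only [Set.mem_Ico, Set.mem_ofPred_eq, Set.mem_union]
    rcases abs_cases i with h | h <;> omega
  have hneg : {i : ℤ | -i ∈ Set.Ico p q} = Set.Ico (1 - q) (1 - p) := by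
    ext i
    simp only [Set.mem_Ico, Set.mem_ofPred_eq]
    omega
  have hd : Disjoint {i : ℤ | -i ∈ Set.Ico p q} (Set.Ico p q) := by
    rw [Set.disjoint_left]
    intro i h1 h2
    simp only [Set.mem_Ico, Set.mem_ofPred_eq] at h1 h2
    omega
  have hp' := hp.one_sub h1 (hpq.trans hqn)
  have hq' := hq.one_sub (h1.trans hpq) hqn
  have hinv : ∀ x ∈ H, coordProj n {i | -i ∈ Set.Ico p q} x ∈ H := by
    intro x
    rw [hneg]
    exact hq'.coordProj_Ico_mem hH hp' (by omega)
  rw [hS, inf_coordSpan_union hd hinv]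
  refine ⟨?_, rfl, fun x hx => ?_⟩
  · refine IsPiece.sup ?_ (hp.isPiece_Ico hH hq hpq) hd
      fun x hx y hy => hH.isotropic x hx.1 y hy.1
    rw [hneg]
    exact hq'.isPiece_Ico hH hp' (by omega)
  · rw [coordProj_add_of_disjoint hd]
    exact H.add_mem (hinv x hx) (hp.coordProj_Ico_mem hH hq hpq hx)

end IsCut

/-! ### Coordinate subspaces as pieces -/

lemma isPiece_coordSpan {n : ℕ} {mu lam : SY n} {S T : Set ℤ} (hTS : T ⊆ S)
    (hT : ∀ i ∈ T, i ∈ Set.Icc (-(n : ℤ)) n ∧ -i ∉ T)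
    (hdim : T.ncard = entryCount mu S)
    (hmu : ∀ t, entryCount mu (S ∩ Set.Ici t) ≤ (T ∩ Set.Ici t).ncard)
    (hlam : ∀ t, entryCount lam (S ∩ Set.Iic t) ≤ (T ∩ Set.Iic t).ncard) :
    IsPiece mu lam S (coordSpan n T) := by
  refine ⟨coordSpan_mono hTS, fun x hx y hy => beta_eq_zero (fun i hi => (hT i hi).2) hx hy,
    ?_, fun t => ?_, fun t => ?_⟩
  · rw [finrank_coordSpan fun i hi => (hT i hi).1, hdim]
  · rw [coordSpan_inf, finrank_coordSpan fun i hi => (hT i hi.1).1]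
    exact hmu t
  · rw [coordSpan_inf, finrank_coordSpan fun i hi => (hT i hi.1).1]
    exact hlam t

lemma SY.neg_notMem_range {n : ℕ} (mu : SY n) {i : ℤ} (hi : i ∈ Set.range mu.seq) :
    -i ∉ Set.range mu.seq := by
  rintro ⟨k, hk⟩
  obtain ⟨j, rfl⟩ := hi
  have h1 := (mu.abs_mem j).1
  have : k = j := mu.abs_injective (by simp [hk])
  subst this
  have : mu.seq k = 0 := by omega
  rw [this] at h1
  simp at h1

/-- The span of the `e_{μ_j}` lies in `X_μ ∩ X'_{λ^c}` if `μ ≤ λ`. -/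
lemma isPiece_coordSpan_range {n : ℕ} {mu lam : SY n} (hle : bruhatLE mu lam) :
    IsPiece mu lam Set.univ (coordSpan n (Set.range mu.seq)) := by
  refine isPiece_coordSpan (Set.subset_univ _) (fun i hi => ⟨?_, mu.neg_notMem_range hi⟩)
    (by simp [entryCount]) (fun t => by simp [entryCount]) fun t => ?_
  · obtain ⟨j, rfl⟩ := hi
    exact mu.mem_Icc j
  · rw [Set.univ_inter]
    change _ ≤ entryCount mu (Set.Iic t)
    rw [entryCount_eq_preimage, entryCount_eq_preimage]
    exact Set.ncard_le_ncard (fun j (hj : lam.seq j ≤ t) => (hle j).trans hj) (Set.toFinite _)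

/-! ### The components of the skew diagram -/

/-- The column `k` contains a box of `λ/μ`. -/
def MeetsColumn {n : ℕ} (mu lam : SY n) (k : ℤ) : Prop :=
  1 ≤ k ∧ ∃ j, mu.seq j < k ∧ k ≤ lam.seq j

section Components

variable {n : ℕ} {mu lam : SY n}

lemma MeetsColumn.le {k : ℤ} (h : MeetsColumn mu lam k) : k ≤ n := by
  obtain ⟨-, j, -, hj⟩ := h
  exact hj.trans (lam.mem_Icc j).2

lemma meetsColumn_box (b : Box mu lam) : MeetsColumn mu lam b.1.2 :=
  ⟨b.2.1, b.1.1, b.2.2.1, b.2.2.2⟩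

lemma not_meetsColumn_zero : ¬MeetsColumn mu lam 0 := fun h => absurd h.1 (by norm_num)

lemma not_meetsColumn_succ : ¬MeetsColumn mu lam (n + 1) := fun h => absurd h.le (by omega)

lemma isCut_iff_not_meetsColumn (hle : bruhatLE mu lam) {k : ℤ} (hk : 1 ≤ k) :
    IsCut mu lam k ↔ ¬MeetsColumn mu lam k := by
  constructor
  · rintro h ⟨-, j, h1, h2⟩
    rw [← lt_entryCount_Ici_iff, ← h, lt_entryCount_Ici_iff] at h2
    omega
  · intro h
    rw [IsCut, entryCount_eq_preimage, entryCount_eq_preimage]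
    congr 1
    ext j
    simp only [Set.mem_preimage, Set.mem_Ici]
    refine ⟨fun h1 => h1.trans (hle j), fun h1 => ?_⟩
    by_contra! h2
    exact h ⟨hk, j, h2, h1⟩

lemma IsCut.of_one_sub {c : ℤ} (h : IsCut mu lam (1 - c)) (h1 : 1 ≤ c) (h2 : c ≤ n + 1) :
    IsCut mu lam c := by
  have h3 := entryCount_Ici_one_sub mu h1 h2
  have h4 := entryCount_Ici_one_sub lam h1 h2
  unfold IsCut at *
  omega

lemma reachable_of_col_eq (b c : Box mu lam) (h : b.1.2 = c.1.2) :
    (boxGraph mu lam).Reachable b c := by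
  have key : ∀ (m : ℕ) (b c : Box mu lam), b.1.2 = c.1.2 → (c.1.1 : ℕ) = b.1.1 + m →
      (boxGraph mu lam).Reachable b c := by
    intro m
    induction m with
    | zero =>
      intro b c h1 h2
      rw [show b = c from Subtype.ext (Prod.ext (Fin.ext h2.symm) h1)]
    | succ m ih =>
      intro b c h1 h2
      have hlt : (b.1.1 : ℕ) + 1 < n := by have := c.1.1.2; omega
      -- the box below `b` lies in the diagram, because the rows of `b` and `c` meet this column
      let b' : Box mu lam := ⟨(⟨b.1.1 + 1, hlt⟩, b.1.2), b.2.1,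
        (mu.strictAnti (show b.1.1 < ⟨b.1.1 + 1, hlt⟩ from Nat.lt_succ_self _)).trans b.2.2.1, by
          have hc := c.2.2.2
          rw [← h1] at hc
          exact hc.trans (lam.strictAnti.antitone (show ⟨b.1.1 + 1, hlt⟩ ≤ c.1.1 from by
            rw [Fin.le_def]; simp only; omega))⟩
      have hadj : (boxGraph mu lam).Adj b b' := by
        refine ⟨fun h => ?_, ?_, ?_⟩
        · have := congrArg (fun t : Box mu lam => (t.1.1 : ℕ)) h
          simp [b'] at this
        · simp [b']
        · simp [b']
      exact hadj.reachable.trans (ih b' c h1 (by simp only [b']; omega))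
  rcases le_total (b.1.1 : ℕ) c.1.1 with h1 | h1
  · exact key _ b c h (Nat.add_sub_cancel' h1).symm
  · exact (key _ c b h.symm (Nat.add_sub_cancel' h1).symm).symm

/-- Boxes in adjacent columns `k` and `k + 1` are connected. If the row `j` of the right box does
not meet column `k`, then `μ_j = k`, so the row `j + 1` meets column `k`, and its box there shares
a vertex with the right box. -/
lemma reachable_of_col_succ (b c : Box mu lam) (h : c.1.2 = b.1.2 + 1) :
    (boxGraph mu lam).Reachable b c := by
  have hb := b.2
  have hc := c.2
  -- it suffices to find some box of the column of `b` that touches `c`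
  suffices ∃ b' : Box mu lam, b'.1.2 = b.1.2 ∧ (boxGraph mu lam).Adj b' c by
    obtain ⟨b', h1, h2⟩ := this
    exact (reachable_of_col_eq b b' h1.symm).trans h2.reachable
  have hne : ∀ b' : Box mu lam, b'.1.2 = b.1.2 → b' ≠ c := by
    rintro b' h1 rfl
    omega
  rcases lt_or_ge (mu.seq c.1.1) b.1.2 with h1 | h1
  · refine ⟨⟨(c.1.1, b.1.2), hb.1, h1, by simp only; omega⟩, rfl, hne _ rfl, ?_, ?_⟩ <;> simp [h]
  · have hlt : c.1.1 < b.1.1 := by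
      by_contra hcon
      have := mu.strictAnti.antitone (not_lt.1 hcon)
      omega
    have hlt' : (c.1.1 : ℕ) + 1 < n := by have := b.1.1.2; rw [Fin.lt_def] at hlt; omega
    refine ⟨⟨(⟨c.1.1 + 1, hlt'⟩, b.1.2), hb.1, ?_, ?_⟩, rfl, hne _ rfl, ?_, ?_⟩
    · have := mu.strictAnti (show c.1.1 < ⟨c.1.1 + 1, hlt'⟩ from Nat.lt_succ_self _)
      simp only
      omega
    · exact hb.2.2.trans (lam.strictAnti.antitone (Nat.succ_le_of_lt hlt))
    · simp
    · simp [h]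

lemma exists_box {k : ℤ} (h : MeetsColumn mu lam k) : ∃ b : Box mu lam, b.1.2 = k := by
  obtain ⟨h1, j, h2, h3⟩ := h
  exact ⟨⟨(j, k), h1, h2, h3⟩, rfl⟩

lemma reachable_of_forall_meetsColumn (b c : Box mu lam) (hbc : b.1.2 ≤ c.1.2)
    (h : ∀ x, b.1.2 ≤ x → x ≤ c.1.2 → MeetsColumn mu lam x) :
    (boxGraph mu lam).Reachable b c := by
  obtain ⟨m, hm⟩ := Int.le.dest hbc
  induction m generalizing c with
  | zero => exact reachable_of_col_eq b c (by simpa using hm)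
  | succ m ih =>
    push_cast at hm
    obtain ⟨c', hc'⟩ := exists_box (h (b.1.2 + m) (by omega) (by omega))
    exact (ih c' (by omega) (fun x h1 h2 => h x h1 (by omega)) hc'.symm).trans
      (reachable_of_col_succ c' c (by omega))

lemma lt_of_reachable {p : ℤ} (hp : ¬MeetsColumn mu lam p) {b c : Box mu lam}
    (h : (boxGraph mu lam).Reachable b c) (hb : b.1.2 < p) : c.1.2 < p := by
  obtain ⟨w⟩ := h
  induction w with
  | nil => exact hb
  | @cons u v w hadj _ ih =>
    refine ih ?_
    by_contra! hv
    have := abs_le.1 hadj.2.2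
    exact hp ((show v.1.2 = p by omega) ▸ meetsColumn_box v)

/-- The columns of a component form a maximal interval of columns that contain boxes. -/
lemma exists_boxCols_eq (d : Component mu lam) : ∃ p q : ℤ, 0 ≤ p ∧ p + 1 < q ∧ q ≤ n + 1 ∧
    ¬MeetsColumn mu lam p ∧ ¬MeetsColumn mu lam q ∧ (∀ x, p < x → x < q → MeetsColumn mu lam x) ∧
    boxCols d = Set.Ioo p q := by
  induction d using SimpleGraph.ConnectedComponent.ind with
  | h b =>
    have hb := meetsColumn_box b
    obtain ⟨p, ⟨hp1, hp2⟩, hp3⟩ := Int.exists_greatest_of_bdd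
      (P := fun z => ¬MeetsColumn mu lam z ∧ z < b.1.2) ⟨b.1.2, fun z hz => hz.2.le⟩
      ⟨0, not_meetsColumn_zero, by have := hb.1; omega⟩
    obtain ⟨q, ⟨hq1, hq2⟩, hq3⟩ := Int.exists_least_of_bdd
      (P := fun z => ¬MeetsColumn mu lam z ∧ b.1.2 < z) ⟨b.1.2, fun z hz => hz.2.le⟩
      ⟨n + 1, not_meetsColumn_succ, by have := hb.le; omega⟩
    have hm : ∀ x, p < x → x < q → MeetsColumn mu lam x := by
      intro x h1 h2
      by_contra hx
      rcases lt_trichotomy x b.1.2 with h | rfl | h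
      · have := hp3 x ⟨hx, h⟩
        omega
      · exact hx hb
      · have := hq3 x ⟨hx, h⟩
        omega
    refine ⟨p, q, hp3 0 ⟨not_meetsColumn_zero, by have := hb.1; omega⟩, by omega,
      hq3 _ ⟨not_meetsColumn_succ, by have := hb.le; omega⟩, hp1, hq1, hm, ?_⟩
    ext k
    constructor
    · rintro ⟨c, hc, rfl⟩
      have hr := SimpleGraph.ConnectedComponent.exact hc
      refine ⟨?_, lt_of_reachable hq1 hr.symm hq2⟩
      by_contra! hcp
      rcases hcp.lt_or_eq with h | h
      · exact absurd (lt_of_reachable hp1 hr h) (by omega)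
      · exact hp1 (h ▸ meetsColumn_box c)
    · rintro ⟨h1, h2⟩
      obtain ⟨c, rfl⟩ := exists_box (hm k h1 h2)
      refine ⟨c, SimpleGraph.ConnectedComponent.sound ?_, rfl⟩
      rcases le_total b.1.2 c.1.2 with h | h
      · exact (reachable_of_forall_meetsColumn b c h
          fun x _ _ => hm x (by omega) (by omega)).symm
      · exact reachable_of_forall_meetsColumn c b h fun x _ _ => hm x (by omega) (by omega)

lemma exists_col_eq (d : Component mu lam) : ∃ p q : ℤ, 0 ≤ p ∧ p + 1 < q ∧ q ≤ n + 1 ∧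
    ¬MeetsColumn mu lam p ∧ ¬MeetsColumn mu lam q ∧ (∀ x, p < x → x < q → MeetsColumn mu lam x) ∧
    boxCols d = Set.Ioo p q ∧ col d = Set.Ico p q := by
  obtain ⟨p, q, h1, h2, h3, h4, h5, h6, h7⟩ := exists_boxCols_eq d
  refine ⟨p, q, h1, h2, h3, h4, h5, h6, h7, ?_⟩
  have hl : ∀ k, IsLeast (Set.Ioo p q) (k + 1) ↔ k = p := by
    intro k
    constructor
    · rintro ⟨⟨ha, hb⟩, hc⟩
      have := hc ⟨lt_add_one p, h2⟩
      omega
    · rintro rfl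
      exact ⟨⟨lt_add_one k, h2⟩, fun x hx => hx.1⟩
  ext k
  simp only [col, h7, hl, Set.mem_union, Set.mem_Ioo, Set.mem_ofPred_eq, Set.mem_Ico]
  omega

lemma exists_mem_boxCols {k : ℤ} (h : MeetsColumn mu lam k) :
    ∃ d : Component mu lam, k ∈ boxCols d := by
  obtain ⟨b, rfl⟩ := exists_box h
  exact ⟨_, b, rfl, rfl⟩

lemma eq_of_mem_boxCols {d d' : Component mu lam} {k : ℤ} (h : k ∈ boxCols d)
    (h' : k ∈ boxCols d') : d = d' := by
  obtain ⟨b, rfl, rfl⟩ := h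
  obtain ⟨c, rfl, hc⟩ := h'
  exact SimpleGraph.ConnectedComponent.sound (reachable_of_col_eq b c hc.symm)

lemma eq_of_mem_col {d d' : Component mu lam} {k : ℤ} (h : k ∈ col d) (h' : k ∈ col d') :
    d = d' := by
  obtain ⟨p, q, -, h1, -, h2, -, h3, h4, h5⟩ := exists_col_eq d
  obtain ⟨p', q', -, h1', -, h2', -, h3', h4', h5'⟩ := exists_col_eq d'
  rw [h5, Set.mem_Ico] at h
  rw [h5', Set.mem_Ico] at h'
  by_cases hk : MeetsColumn mu lam k
  · refine eq_of_mem_boxCols (k := k) (h4 ▸ ⟨lt_of_le_of_ne h.1 ?_, h.2⟩)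
      (h4' ▸ ⟨lt_of_le_of_ne h'.1 ?_, h'.2⟩)
    · rintro rfl
      exact h2 hk
    · rintro rfl
      exact h2' hk
  · have hp : k = p := by
      by_contra hne
      exact hk (h3 k (by omega) h.2)
    have hp' : k = p' := by
      by_contra hne
      exact hk (h3' k (by omega) h'.2)
    subst hp
    subst hp'
    exact eq_of_mem_boxCols (k := k + 1) (h4 ▸ ⟨by omega, h1⟩) (h4' ▸ ⟨by omega, h1'⟩)

lemma exists_mem_col_of_meetsColumn {k : ℤ} (h : MeetsColumn mu lam k) :
    ∃ d : Component mu lam, k ∈ col d :=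
  (exists_mem_boxCols h).imp fun _ hd => Or.inl hd

lemma exists_mem_col_of_meetsColumn_succ {k : ℤ} (h : MeetsColumn mu lam (k + 1)) :
    ∃ d : Component mu lam, k ∈ col d := by
  obtain ⟨d, hd⟩ := exists_mem_boxCols h
  refine ⟨d, ?_⟩
  obtain ⟨p, q, h0, h1, -, h2, -, h3, h4, h5⟩ := exists_col_eq d
  rw [h4, Set.mem_Ioo] at hd
  rw [h5, Set.mem_Ico]
  omega

/-! ### The index sets of the factors -/

lemma exists_factorCols_none : ∃ q : ℤ, 1 ≤ q ∧ q ≤ n + 1 ∧ ¬MeetsColumn mu lam q ∧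
    (∀ x, 1 ≤ x → x < q → MeetsColumn mu lam x) ∧
    factorCols (none : FactorIdx mu lam) = Set.Ico 1 q := by
  by_cases h1 : MeetsColumn mu lam 1
  · obtain ⟨d, hd⟩ := exists_mem_boxCols h1
    obtain ⟨p, q, hp, hpq, hq, -, hmq, hm, hb, hc⟩ := exists_col_eq d
    rw [hb, Set.mem_Ioo] at hd
    obtain rfl : p = 0 := by omega
    refine ⟨q, by omega, hq, hmq, fun x hx => hm x (by omega), ?_⟩
    ext k
    constructor
    · rintro ⟨hk, d', h0, hd'⟩
      rw [eq_of_mem_col h0 (show 0 ∈ col d from hc ▸ ⟨le_rfl, by omega⟩), hc] at hd'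
      exact ⟨hk, hd'.2⟩
    · rintro ⟨hk, hkq⟩
      exact ⟨hk, d, hc ▸ ⟨le_rfl, by omega⟩, hc ▸ ⟨by omega, hkq⟩⟩
  · refine ⟨1, le_rfl, by omega, h1, fun x h2 h3 => by omega, ?_⟩
    rw [Set.Ico_self]
    refine Set.eq_empty_of_forall_notMem ?_
    rintro k ⟨-, d, h0, -⟩
    obtain ⟨p, q, hp, hpq, -, -, -, hm, -, hc⟩ := exists_col_eq d
    rw [hc, Set.mem_Ico] at h0
    exact h1 (hm 1 (by omega) (by omega))

lemma exists_factorCols_some (d : {d : Component mu lam // (0 : ℤ) ∉ col d}) : ∃ p q : ℤ,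
    1 ≤ p ∧ p < q ∧ q ≤ n + 1 ∧ ¬MeetsColumn mu lam p ∧ ¬MeetsColumn mu lam q ∧
    (∀ x, p < x → x < q → MeetsColumn mu lam x) ∧ MeetsColumn mu lam (p + 1) ∧
    factorCols (some d : FactorIdx mu lam) = Set.Ico p q := by
  obtain ⟨p, q, hp, hpq, hq, hmp, hmq, hm, -, hc⟩ := exists_col_eq d.1
  have h0 := d.2
  rw [hc, Set.mem_Ico] at h0
  exact ⟨p, q, by omega, by omega, hq, hmp, hmq, hm, hm _ (by omega) hpq, hc⟩

lemma factorCols_subset (c : FactorIdx mu lam) : factorCols c ⊆ Set.Icc 1 (n : ℤ) := by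
  match c with
  | none =>
    obtain ⟨q, h1, h2, -, -, h3⟩ := exists_factorCols_none (mu := mu) (lam := lam)
    rw [h3]
    exact fun k hk => ⟨hk.1, by have := hk.2; omega⟩
  | some d =>
    obtain ⟨p, q, h1, -, h2, -, -, -, -, h3⟩ := exists_factorCols_some d
    rw [h3]
    exact fun k hk => ⟨h1.trans hk.1, by have := hk.2; omega⟩

lemma eq_of_mem_factorCols {c c' : FactorIdx mu lam} {k : ℤ} (h : k ∈ factorCols c)
    (h' : k ∈ factorCols c') : c = c' := by
  match c, c' with
  | none, none => rfl
  | none, some d =>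
    obtain ⟨-, d0, h0, hk⟩ := h
    exact absurd (eq_of_mem_col hk h' ▸ h0) d.2
  | some d, none =>
    obtain ⟨-, d0, h0, hk⟩ := h'
    exact absurd (eq_of_mem_col hk h ▸ h0) d.2
  | some d, some d' => exact congrArg some (Subtype.ext (eq_of_mem_col h h'))

lemma exists_mem_factorCols {k : ℤ} (hk : 1 ≤ k) {d : Component mu lam} (h : k ∈ col d) :
    ∃ c : FactorIdx mu lam, k ∈ factorCols c := by
  by_cases h0 : (0 : ℤ) ∈ col d
  · exact ⟨none, hk, d, h0, h⟩
  · exact ⟨some ⟨d, h0⟩, h⟩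

lemma meetsColumn_of_mem_factorCols {c : FactorIdx mu lam} {k : ℤ} (h : k ∈ factorCols c) :
    MeetsColumn mu lam k ∨ MeetsColumn mu lam (k + 1) := by
  match c with
  | none =>
    obtain ⟨q, -, -, -, hm, hc⟩ := exists_factorCols_none (mu := mu) (lam := lam)
    rw [hc] at h
    exact Or.inl (hm k h.1 h.2)
  | some d =>
    obtain ⟨p, q, -, -, -, -, -, hm, hm', hc⟩ := exists_factorCols_some d
    rw [hc] at h
    rcases h.1.eq_or_lt with rfl | hlt
    · exact Or.inr hm'
    · exact Or.inl (hm k hlt h.2)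

/-- The indices `i` of the basis vectors `e_i` in the space `V_0`, or `V_d^+ ⊕ V_d^-`, of a
factor. -/
def factorSupport : FactorIdx mu lam → Set ℤ
  | none => {i | i = 0 ∨ |i| ∈ factorCols (none : FactorIdx mu lam)}
  | some d => {i | |i| ∈ factorCols (some d)}

/-- The common entries `μ_j = λ_j` of the two sequences, which index the basis of `H_φ`. -/
def commonEntries (mu lam : SY n) : Set ℤ := {i | ∃ j, mu.seq j = lam.seq j ∧ i = mu.seq j}

lemma mem_factorSupport_iff {c : FactorIdx mu lam} {i : ℤ} (hi : i ≠ 0) :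
    i ∈ factorSupport c ↔ |i| ∈ factorCols c := by
  match c with
  | none => simp [factorSupport, hi]
  | some d => rfl

lemma zero_mem_factorSupport_iff {c : FactorIdx mu lam} : 0 ∈ factorSupport c ↔ c = none := by
  match c with
  | none => simp [factorSupport]
  | some d =>
    simp only [factorSupport, Set.mem_ofPred_eq, abs_zero, reduceCtorEq, iff_false]
    exact d.2

lemma neg_mem_factorSupport {c : FactorIdx mu lam} {i : ℤ} (h : i ∈ factorSupport c) :
    -i ∈ factorSupport c := by
  by_cases hi : i = 0
  · simpa [hi] using h
  · rw [mem_factorSupport_iff hi] at h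
    rwa [mem_factorSupport_iff (neg_ne_zero.2 hi), abs_neg]

lemma disjoint_factorSupport {c c' : FactorIdx mu lam} (h : c ≠ c') :
    Disjoint (factorSupport c) (factorSupport c') := by
  rw [Set.disjoint_left]
  intro i h1 h2
  by_cases hi : i = 0
  · subst hi
    exact h ((zero_mem_factorSupport_iff.1 h1).trans (zero_mem_factorSupport_iff.1 h2).symm)
  · exact h (eq_of_mem_factorCols ((mem_factorSupport_iff hi).1 h1)
      ((mem_factorSupport_iff hi).1 h2))

lemma SY.ne_zero_of_mem_range {nu : SY n} {v : ℤ} (hv : v ∈ Set.range nu.seq) : v ≠ 0 := by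
  obtain ⟨j, rfl⟩ := hv
  intro h
  have := (nu.abs_mem j).1
  simp [h] at this

/-- A common entry `v` of the two sequences is isolated between the cuts `v` and `v + 1`. -/
lemma isCut_of_mem_commonEntries {v : ℤ} (hv : v ∈ commonEntries mu lam) :
    IsCut mu lam v ∧ IsCut mu lam (v + 1) := by
  obtain ⟨j, hj, rfl⟩ := hv
  have key : ∀ nu : SY n, nu.seq j = mu.seq j →
      entryCount nu (Set.Ici (mu.seq j)) = j + 1 ∧ entryCount nu (Set.Ici (mu.seq j + 1)) = j := by
    intro nu hnu
    have h1 := (lt_entryCount_Ici_iff nu (mu.seq j) j).2 hnu.ge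
    have h2 := (lt_entryCount_Ici_iff nu (mu.seq j + 1) j).not.2 (by omega)
    have h3 := entryCount_Ico_add_Ici nu (show mu.seq j ≤ mu.seq j + 1 by omega)
    have h4 : entryCount nu (Set.Ico (mu.seq j) (mu.seq j + 1)) ≤ 1 := by
      rw [entryCount]
      refine (Set.ncard_le_ncard Set.inter_subset_right (Set.finite_Ico _ _)).trans ?_
      rw [← Finset.coe_Ico, Set.ncard_coe_finset, Int.card_Ico]
      omega
    omega
  have h1 := key mu rfl
  have h2 := key lam hj.symm
  exact ⟨h1.1.trans h2.1.symm, h1.2.trans h2.2.symm⟩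

lemma disjoint_commonEntries_factorSupport (hle : bruhatLE mu lam) (c : FactorIdx mu lam) :
    Disjoint (commonEntries mu lam) (factorSupport c) := by
  rw [Set.disjoint_left]
  intro v hv hc
  have hv' := hv
  obtain ⟨j, -, rfl⟩ := hv'
  obtain ⟨h1, h2⟩ := isCut_of_mem_commonEntries hv
  rw [mem_factorSupport_iff (SY.ne_zero_of_mem_range ⟨j, rfl⟩)] at hc
  have h3 := mu.abs_mem j
  rw [Set.mem_Icc] at h3
  have : IsCut mu lam |mu.seq j| ∧ IsCut mu lam (|mu.seq j| + 1) := by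
    rcases abs_cases (mu.seq j) with ⟨h, -⟩ | ⟨h, -⟩
    · rw [h]
      exact ⟨h1, h2⟩
    · rw [h] at h3 ⊢
      exact ⟨IsCut.of_one_sub (by rwa [sub_neg_eq_add, add_comm]) h3.1 (by omega),
        IsCut.of_one_sub (by rwa [show 1 - (-mu.seq j + 1) = mu.seq j by ring])
          (by omega) (by omega)⟩
  rw [isCut_iff_not_meetsColumn hle h3.1, isCut_iff_not_meetsColumn hle (by omega)] at this
  exact (meetsColumn_of_mem_factorCols hc).elim this.1 this.2

lemma isCut_of_forall_notMem_factorSupport (hle : bruhatLE mu lam) {v : ℤ} (hv : v ≠ 0)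
    (hn : |v| ≤ n) (h : ∀ c : FactorIdx mu lam, v ∉ factorSupport c) :
    IsCut mu lam v ∧ IsCut mu lam (v + 1) := by
  have h1 : 1 ≤ |v| := Int.one_le_abs hv
  have h2 : ∀ d : Component mu lam, |v| ∉ col d := by
    intro d hd
    obtain ⟨c, hc⟩ := exists_mem_factorCols h1 hd
    exact h c ((mem_factorSupport_iff hv).2 hc)
  have h3 : IsCut mu lam |v| := (isCut_iff_not_meetsColumn hle h1).2 fun hm =>
    (exists_mem_col_of_meetsColumn hm).elim h2
  have h4 : IsCut mu lam (|v| + 1) := (isCut_iff_not_meetsColumn hle (by omega)).2 fun hm =>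
    (exists_mem_col_of_meetsColumn_succ hm).elim h2
  rcases abs_cases v with ⟨h, -⟩ | ⟨h, -⟩
  · rw [h] at h3 h4
    exact ⟨h3, h4⟩
  · have h5 := h3.one_sub h1 (by omega)
    have h6 := h4.one_sub (by omega) (by omega)
    rw [h] at h5 h6
    exact ⟨by rwa [show 1 - (-v + 1) = v by ring] at h6,
      by rwa [show 1 - -v = v + 1 by ring] at h5⟩

lemma eq_of_isCut {v : ℤ} (h1 : IsCut mu lam v) (h2 : IsCut mu lam (v + 1)) (j : Fin n) :
    mu.seq j = v ↔ lam.seq j = v := by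
  have h3 := lt_entryCount_Ici_iff mu v j
  have h4 := lt_entryCount_Ici_iff mu (v + 1) j
  rw [h1, lt_entryCount_Ici_iff] at h3
  rw [h2, lt_entryCount_Ici_iff] at h4
  omega

lemma range_mu_subset_union (hle : bruhatLE mu lam) :
    Set.range mu.seq ⊆ commonEntries mu lam ∪ ⋃ c : FactorIdx mu lam, factorSupport c := by
  rintro _ ⟨j, rfl⟩
  rw [Set.mem_union, Set.mem_iUnion, or_iff_not_imp_right, not_exists]
  intro h
  obtain ⟨h1, h2⟩ := isCut_of_forall_notMem_factorSupport hle
    (SY.ne_zero_of_mem_range ⟨j, rfl⟩) (mu.abs_mem j).2 h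
  exact ⟨j, ((eq_of_isCut h1 h2 j).1 rfl).symm, rfl⟩

lemma range_lam_subset_union (hle : bruhatLE mu lam) :
    Set.range lam.seq ⊆ commonEntries mu lam ∪ ⋃ c : FactorIdx mu lam, factorSupport c := by
  rintro _ ⟨j, rfl⟩
  rw [Set.mem_union, Set.mem_iUnion, or_iff_not_imp_right, not_exists]
  intro h
  obtain ⟨h1, h2⟩ := isCut_of_forall_notMem_factorSupport hle
    (SY.ne_zero_of_mem_range ⟨j, rfl⟩) (lam.abs_mem j).2 h
  have := (eq_of_isCut h1 h2 j).2 rfl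
  exact ⟨j, this, this.symm⟩

instance : Finite (Box mu lam) := by
  refine Finite.of_injective (β := Fin n × Set.Icc (1 : ℤ) n)
    (fun b => (b.1.1, ⟨b.1.2, b.2.1, b.2.2.2.trans (lam.mem_Icc _).2⟩)) ?_
  rintro ⟨⟨i, k⟩, h⟩ ⟨⟨i', k'⟩, h'⟩ heq
  simp only [Prod.mk.injEq] at heq
  exact Subtype.ext (Prod.ext heq.1 (congrArg Subtype.val heq.2))

instance : Finite (Component mu lam) := Quot.finite _

end Components

/-! ### Taking apart and reassembling a point of the Richardson variety -/

section Decomposition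

variable {n : ℕ} {mu lam : SY n}

lemma factorSupport_none_eq {q : ℤ}
    (hq : factorCols (none : FactorIdx mu lam) = Set.Ico 1 q) (h1 : 1 ≤ q) :
    factorSupport (none : FactorIdx mu lam) = Set.Ico (1 - q) q := by
  ext i
  simp only [factorSupport, hq, Set.mem_Ico, Set.mem_ofPred_eq]
  rcases abs_cases i with h | h <;> omega

lemma Vzero_eq : Vzero mu lam = coordSpan n (factorSupport (none : FactorIdx mu lam)) := by
  unfold Vzero
  congr 1
  ext i
  simp only [factorSupport, factorCols, Set.mem_ofPred_eq]
  by_cases hi : i = 0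
  · simp [hi]
  simp only [hi, false_or]
  have hnn : ∀ (d : Component mu lam) (k : ℤ), k ∈ col d → 0 ≤ k := by
    intro d k hk
    obtain ⟨p, q, hp, -, -, -, -, -, -, hc⟩ := exists_col_eq d
    rw [hc] at hk
    exact hp.trans hk.1
  have h1 : 1 ≤ |i| := Int.one_le_abs hi
  constructor
  · rintro ⟨d, h0, h | h⟩
    · exact ⟨h1, d, h0, by rwa [abs_of_nonneg (hnn d i h)]⟩
    · exact ⟨h1, d, h0, by rwa [← abs_neg, abs_of_nonneg (hnn d _ h)]⟩
  · rintro ⟨-, d, h0, h⟩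
    refine ⟨d, h0, ?_⟩
    rcases abs_choice i with h' | h' <;> rw [h'] at h
    · exact Or.inl h
    · exact Or.inr h

/-- The set of columns of a factor lies between cuts, at which `H` splits. -/
lemma IsPiece.part_spec (hle : bruhatLE mu lam) {H : Submodule ℂ (V n)}
    (hH : IsPiece mu lam Set.univ H) (c : FactorIdx mu lam) :
    part H c = H ⊓ coordSpan n (factorSupport c) ∧
    IsPiece mu lam (factorSupport c) (part H c) ∧
    ∀ x ∈ H, coordProj n (factorSupport c) x ∈ H := by
  match c with
  | none =>
    obtain ⟨q, h1, h2, hq, -, hc⟩ := exists_factorCols_none (mu := mu) (lam := lam)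
    have hcut := (isCut_iff_not_meetsColumn hle h1).2 hq
    have hcut' := hcut.one_sub h1 h2
    have heq : part H none = H ⊓ coordSpan n (factorSupport (none : FactorIdx mu lam)) :=
      congrArg (H ⊓ ·) Vzero_eq
    refine ⟨heq, ?_, ?_⟩
    · rw [heq, factorSupport_none_eq hc h1]
      exact hcut'.isPiece_Ico hH hcut (by omega)
    · rw [factorSupport_none_eq hc h1]
      exact fun x => hcut'.coordProj_Ico_mem hH hcut (by omega)
  | some d =>
    obtain ⟨p, q, h1, h2, h3, hp, hq, -, -, hc⟩ := exists_factorCols_some d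
    have hcut := (isCut_iff_not_meetsColumn hle h1).2 hp
    have hcut' := (isCut_iff_not_meetsColumn hle (h1.trans h2.le)).2 hq
    obtain ⟨h4, h5, h6⟩ := isPiece_symm_Ico hH hcut hcut' h1 h2.le h3
    have hs : factorSupport (some d) = {i | |i| ∈ Set.Ico p q} := by rw [← hc]; rfl
    have heq : part H (some d) = H ⊓ coordSpan n (factorSupport (some d)) := by
      rw [hs, h5, ← hc]
      rfl
    rw [heq, hs]
    exact ⟨rfl, h4, h6⟩

lemma isPiece_Hphi : IsPiece mu lam (commonEntries mu lam) (Hphi mu lam) := by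
  have hmu : commonEntries mu lam ⊆ Set.range mu.seq := by
    rintro _ ⟨j, -, rfl⟩
    exact ⟨j, rfl⟩
  have hlam : commonEntries mu lam ⊆ Set.range lam.seq := by
    rintro _ ⟨j, h, rfl⟩
    exact ⟨j, h.symm⟩
  refine isPiece_coordSpan subset_rfl (fun i hi => ⟨?_, fun h =>
    mu.neg_notMem_range (hmu hi) (hmu h)⟩) ?_ (fun t => ?_) fun t => ?_
  · obtain ⟨j, -, rfl⟩ := hi
    exact mu.mem_Icc j
  · rw [entryCount, Set.inter_eq_self_of_subset_right hmu]
    rfl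
  · rw [entryCount, Set.inter_eq_self_of_subset_right (Set.inter_subset_left.trans hmu)]
    exact le_rfl
  · rw [entryCount, Set.inter_eq_self_of_subset_right (Set.inter_subset_left.trans hlam)]
    exact le_rfl

lemma isPiece_union (hle : bruhatLE mu lam) {W : FactorIdx mu lam → Submodule ℂ (V n)}
    (hW : ∀ c, IsPiece mu lam (factorSupport c) (W c)) (s : Finset (FactorIdx mu lam)) :
    IsPiece mu lam (commonEntries mu lam ∪ ⋃ c ∈ s, factorSupport c)
      (Hphi mu lam ⊔ ⨆ c ∈ s, W c) :=
  isPiece_Hphi.iSup s hW (disjoint_commonEntries_factorSupport hle)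
    (fun _ _ h => disjoint_factorSupport h) fun _ _ => neg_mem_factorSupport

/-- Pieces on the supports of all the factors can be combined at will. -/
lemma isPiece_assemble (hle : bruhatLE mu lam) {W : FactorIdx mu lam → Submodule ℂ (V n)}
    (hW : ∀ c, IsPiece mu lam (factorSupport c) (W c)) :
    IsPiece mu lam Set.univ (Hphi mu lam ⊔ ⨆ c, W c) := by
  cases nonempty_fintype (FactorIdx mu lam)
  have h := isPiece_union hle hW Finset.univ
  simp only [Finset.mem_univ, Set.iUnion_true, iSup_pos] at h
  have key : ∀ nu : SY n, Set.range nu.seq ⊆ commonEntries mu lam ∪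
      ⋃ c : FactorIdx mu lam, factorSupport c → ∀ R,
      entryCount nu ((commonEntries mu lam ∪ ⋃ c : FactorIdx mu lam, factorSupport c) ∩ R) =
        entryCount nu (Set.univ ∩ R) := by
    intro nu hnu R
    rw [entryCount, ← Set.inter_assoc, Set.inter_eq_self_of_subset_left hnu, Set.univ_inter]
    rfl
  refine ⟨by simp [coordSpan_univ], h.isotropic, ?_, fun t => ?_, fun t => ?_⟩
  · have := key mu (range_mu_subset_union hle) Set.univ
    rw [Set.inter_univ, Set.inter_univ] at this
    rw [h.finrank_eq, this]
  · rw [← key mu (range_mu_subset_union hle)]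
    exact h.le_finrank_Ici t
  · rw [← key lam (range_lam_subset_union hle)]
    exact h.le_finrank_Iic t

lemma part_assemble (hle : bruhatLE mu lam) {W : FactorIdx mu lam → Submodule ℂ (V n)}
    (hW : ∀ c, IsPiece mu lam (factorSupport c) (W c)) (c : FactorIdx mu lam) :
    part (Hphi mu lam ⊔ ⨆ c, W c) c = W c := by
  obtain ⟨h1, h2, -⟩ := (isPiece_assemble hle hW).part_spec hle c
  refine (Submodule.eq_of_le_of_finrank_eq ?_ ?_).symm
  · rw [h1]
    exact le_inf ((le_iSup W c).trans le_sup_right) (hW c).le_coordSpan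
  · rw [h2.finrank_eq, (hW c).finrank_eq]

/-- The basis vector of a common entry `v` spans the part of `H` between the cuts `v` and
`v + 1`. -/
lemma e_mem_of_mem_commonEntries {H : Submodule ℂ (V n)} (hH : IsPiece mu lam Set.univ H) {v : ℤ}
    (hv : v ∈ commonEntries mu lam) : e n v ∈ H := by
  obtain ⟨h1, h2⟩ := isCut_of_mem_commonEntries hv
  have h3 := (h1.isPiece_Ico hH h2 (by omega)).finrank_eq
  have hv' : v ∈ Set.range mu.seq ∩ Set.Ico v (v + 1) := by
    obtain ⟨j, -, rfl⟩ := hv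
    exact ⟨⟨j, rfl⟩, le_rfl, lt_add_one _⟩
  have h4 : 0 < entryCount mu (Set.Ico v (v + 1)) :=
    (Set.ncard_pos (mu.finite_range_inter _)).2 ⟨v, hv'⟩
  rw [← h3, Module.finrank_pos_iff_exists_ne_zero] at h4
  obtain ⟨⟨x, hx, hx'⟩, hne⟩ := h4
  have : coordSpan n (Set.Ico v (v + 1)) = Submodule.span ℂ {e n v} := by
    rw [coordSpan, show Set.Ico v (v + 1) = {v} by ext i; simp; omega, Set.image_singleton]
  rw [this] at hx'
  obtain ⟨a, rfl⟩ := Submodule.mem_span_singleton.1 hx'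
  have ha : a ≠ 0 := by
    rintro rfl
    exact hne (by simp)
  exact (Submodule.smul_mem_iff _ ha).1 hx

lemma Hphi_le {H : Submodule ℂ (V n)} (hH : IsPiece mu lam Set.univ H) : Hphi mu lam ≤ H := by
  refine Submodule.span_le.2 ?_
  rintro _ ⟨v, hv, rfl⟩
  exact e_mem_of_mem_commonEntries hH hv

lemma assemble_part (hle : bruhatLE mu lam) {H : Submodule ℂ (V n)}
    (hH : IsPiece mu lam Set.univ H) : Hphi mu lam ⊔ ⨆ c, part (mu := mu) (lam := lam) H c = H := by
  refine Submodule.eq_of_le_of_finrank_eq (sup_le (Hphi_le hH) (iSup_le fun c => ?_)) ?_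
  · rw [(hH.part_spec hle c).1]
    exact inf_le_left
  · rw [(isPiece_assemble hle fun c => (hH.part_spec hle c).2.1).finrank_eq, hH.finrank_eq]

lemma mem_factor_iff (hle : bruhatLE mu lam) {c : FactorIdx mu lam} {W : Submodule ℂ (V n)} :
    W ∈ factor mu lam c ↔ IsPiece mu lam (factorSupport c) W := by
  classical
  constructor
  · rintro ⟨H, hH, rfl⟩
    exact ((mem_richardson_iff.1 hH).part_spec hle c).2.1
  · intro hW
    -- the other parts are those of the span of the `e_{μ_j}`
    have h0 := isPiece_coordSpan_range hle
    have hU : ∀ c', IsPiece mu lam (factorSupport c')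
        (Function.update (part (coordSpan n (Set.range mu.seq))) c W c') := by
      intro c'
      by_cases hc : c' = c
      · subst hc
        simpa using hW
      · simpa [hc] using (h0.part_spec hle c').2.1
    refine ⟨_, mem_richardson_iff.2 (isPiece_assemble hle hU), ?_⟩
    simpa using part_assemble hle hU c

lemma inf_Vphi_eq {H : Submodule ℂ (V n)} (hH : IsPiece mu lam Set.univ H) :
    H ⊓ Vphi mu lam = Hphi mu lam := by
  refine le_antisymm ?_ (le_inf (Hphi_le hH) (coordSpan_mono ?_))
  · rintro x ⟨hx, hx'⟩
    refine mem_coordSpan.2 fun k hk => ?_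
    by_cases hneg : -(k : ℤ) ∈ commonEntries mu lam
    · -- `H` is isotropic and contains `e_{-k}`
      have hk' := Finset.mem_Icc.1 k.2
      let m : Idx n := ⟨-k, Finset.mem_Icc.2 (by omega)⟩
      rw [← beta_e_right x k m (by simp [m])]
      exact hH.isotropic x hx _ (e_mem_of_mem_commonEntries hH hneg)
    · refine mem_coordSpan.1 hx' k ?_
      rintro ⟨j, hj, h | h⟩
      · exact hk ⟨j, hj, h⟩
      · exact hneg ⟨j, hj, by omega⟩
  · rintro _ ⟨j, hj, rfl⟩
    exact ⟨j, hj, Or.inl rfl⟩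

lemma factorDim_eq (c : FactorIdx mu lam) : factorDim c = entryCount mu (factorSupport c) ∧
    factorDim c = entryCount lam (factorSupport c) := by
  have key : ∀ nu : SY n, factorDim c = entryCount nu (factorSupport c) := by
    intro nu
    rw [factorDim, ← entryCount_abs_preimage nu _ (factorCols_subset c), entryCount, entryCount]
    congr 1
    ext i
    simp only [Set.mem_inter_iff, Set.mem_ofPred_eq]
    exact and_congr_right fun hi => (mem_factorSupport_iff (SY.ne_zero_of_mem_range hi)).symm
  exact ⟨key mu, key lam⟩

/-- The bijection between tuples of points of the factors and points of `X_μ ∩ X'_{λ^c}`. -/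
noncomputable def factorEquiv (hle : bruhatLE mu lam) :
    ((c : FactorIdx mu lam) → ↥(factor mu lam c)) ≃ ↥(schubert mu ∩ schubertOpp lam) where
  toFun x := ⟨Hphi mu lam ⊔ ⨆ c, (x c : Submodule ℂ (V n)),
    mem_richardson_iff.2 (isPiece_assemble hle fun c => (mem_factor_iff hle).1 (x c).2)⟩
  invFun H c := ⟨part H c, H, H.2, rfl⟩
  left_inv x := funext fun c => Subtype.ext <|
    part_assemble hle (fun c => (mem_factor_iff hle).1 (x c).2) c
  right_inv H := Subtype.ext <| assemble_part hle (mem_richardson_iff.1 H.2)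

end Decomposition

/-! ### Regularity in frames -/

section Regularity

variable {n : ℕ} {mu lam : SY n}

lemma finrank_factor (hle : bruhatLE mu lam) {c : FactorIdx mu lam}
    (W : ↥(factor mu lam c)) : Module.finrank ℂ (W : Submodule ℂ (V n)) = factorDim c := by
  rw [((mem_factor_iff hle).1 W.2).finrank_eq, (factorDim_eq c).1]

lemma finrank_richardson (H : ↥(schubert mu ∩ schubertOpp lam)) :
    Module.finrank ℂ (H : Submodule ℂ (V n)) = n := H.2.1.1.2

lemma entryCount_biUnion (nu : SY n) {I : Type*} (s : Finset I) {S : I → Set ℤ}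
    (hS : Pairwise fun i j => Disjoint (S i) (S j)) :
    entryCount nu (⋃ i ∈ s, S i) = ∑ i ∈ s, entryCount nu (S i) := by
  classical
  induction s using Finset.induction_on with
  | empty => simp [entryCount_empty]
  | insert i s hi ih =>
    rw [Finset.set_biUnion_insert, entryCount_union, ih, Finset.sum_insert hi]
    simp only [Set.disjoint_iUnion_right]
    exact fun j hj => hS fun h => hi (h ▸ hj)

/-- A frame of the assembled space has one vector for each member of the frames of the parts, and
one for each common entry. -/
lemma nonempty_frameIndex_equiv (hle : bruhatLE mu lam) :
    Nonempty (Fin n ≃ (Σ c : FactorIdx mu lam, Fin (factorDim c)) ⊕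
      {j : Fin n // mu.seq j = lam.seq j}) := by
  classical
  cases nonempty_fintype (FactorIdx mu lam)
  refine ⟨Fintype.equivOfCardEq ?_⟩
  rw [Fintype.card_sum, Fintype.card_sigma, Fintype.card_fin]
  simp only [Fintype.card_fin, (factorDim_eq _).1]
  rw [← entryCount_biUnion mu Finset.univ fun _ _ h => disjoint_factorSupport h]
  have h1 : Fintype.card {j : Fin n // mu.seq j = lam.seq j} =
      entryCount mu (commonEntries mu lam) := by
    rw [entryCount_eq_preimage, ← Nat.card_eq_fintype_card, ← Set.coe_ofPred, Nat.card_coe_set_eq]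
    congr 1
    ext j
    simp only [Set.mem_ofPred_eq, Set.mem_preimage]
    exact ⟨fun h => ⟨j, h, rfl⟩, fun ⟨i, h, hij⟩ => mu.strictAnti.injective hij ▸ h⟩
  rw [h1, add_comm, ← entryCount_union]
  · conv_lhs => rw [← entryCount_univ mu]
    rw [entryCount, entryCount, Set.inter_univ, Set.inter_eq_self_of_subset_left]
    simpa using range_mu_subset_union hle
  · simp only [Finset.mem_univ, Set.iUnion_true, Set.disjoint_iUnion_right]
    exact disjoint_commonEntries_factorSupport hle

lemma isRegularMap_factorEquiv (hle : bruhatLE mu lam) :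
    IsRegularMap (factorDim (mu := mu) (lam := lam)) (fun _ : Unit => n)
      (fun (x : (c : FactorIdx mu lam) → ↥(factor mu lam c)) c => (x c : Submodule ℂ (V n)))
      (fun (H : ↥(schubert mu ∩ schubertOpp lam)) _ => (H : Submodule ℂ (V n)))
      (factorEquiv hle) := by
  refine ⟨fun x c => finrank_factor hle (x c), fun H _ => finrank_richardson H,
    fun x y h => funext fun c => Subtype.ext (congrFun h c),
    fun H K h => Subtype.ext (congrFun h ()), fun x _ => ?_⟩
  obtain ⟨f⟩ := nonempty_frameIndex_equiv hle
  -- the concatenation of the frames of the parts with the basis vectors of `H_φ`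
  let g : Fin n → Idx n →
      MvPolynomial (Σ c : FactorIdx mu lam, Fin (factorDim c) × Idx n) ℂ := fun r s =>
    Sum.elim (fun w : Σ c : FactorIdx mu lam, Fin (factorDim c) =>
        MvPolynomial.X ⟨w.1, w.2, s⟩)
      (fun j => MvPolynomial.C (e n (mu.seq j.1) s)) (f r)
  have hg : ∀ M : ∀ c : FactorIdx mu lam, Fin (factorDim c) → V n, evalAt g M =
      Sum.elim (fun w : Σ c : FactorIdx mu lam, Fin (factorDim c) => M w.1 w.2)
        (fun j : {j : Fin n // mu.seq j = lam.seq j} => e n (mu.seq j.1)) ∘ f := by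
    intro M
    ext r s
    simp only [evalAt, g, Function.comp_apply]
    rcases f r with w | j <;> simp
  have hspan : ∀ (y : (c : FactorIdx mu lam) → ↥(factor mu lam c))
      (M : ∀ c : FactorIdx mu lam, Fin (factorDim c) → V n),
      IsFrame M (fun c => (y c : Submodule ℂ (V n))) →
      Submodule.span ℂ (Set.range (evalAt g M)) = (factorEquiv hle y : Submodule ℂ (V n)) := by
    intro y M hM
    rw [hg, f.surjective.range_comp, Set.Sum.elim_range, Submodule.span_union, sup_comm]
    refine congrArg₂ (· ⊔ ·) ?_ ?_
    · rw [Hphi, coordSpan]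
      congr 1
      ext v
      constructor
      · rintro ⟨j, rfl⟩
        exact ⟨_, ⟨j.1, j.2, rfl⟩, rfl⟩
      · rintro ⟨_, ⟨j, hj, rfl⟩, rfl⟩
        exact ⟨⟨j, hj⟩, rfl⟩
    · rw [Set.range_sigma_eq_iUnion_range, Submodule.span_iUnion]
      exact iSup_congr fun c => (hM c).2
  refine ⟨g, ?_, fun y M hM _ => hspan y M hM⟩
  have hex : ∀ c, ∃ M : Fin (factorDim c) → V n, LinearIndependent ℂ M ∧
      Submodule.span ℂ (Set.range M) = (x c : Submodule ℂ (V n)) := by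
    intro c
    let b := Module.finBasisOfFinrankEq ℂ (x c : Submodule ℂ (V n)) (finrank_factor hle (x c))
    refine ⟨Subtype.val ∘ b, b.linearIndependent.map' (Submodule.subtype _)
      (Submodule.ker_subtype _), ?_⟩
    rw [Set.range_comp, ← Submodule.coe_subtype, ← Submodule.map_span, b.span_eq,
      Submodule.map_subtype_top]
  choose M hM using hex
  refine ⟨M, hM, ?_⟩
  rw [linearIndependent_iff_card_eq_finrank_span, Set.finrank, hspan x M hM, Fintype.card_fin]
  exact (finrank_richardson _).symm

lemma isRegularMap_factorEquiv_symm (hle : bruhatLE mu lam) :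
    IsRegularMap (fun _ : Unit => n) (factorDim (mu := mu) (lam := lam))
      (fun (H : ↥(schubert mu ∩ schubertOpp lam)) _ => (H : Submodule ℂ (V n)))
      (fun (x : (c : FactorIdx mu lam) → ↥(factor mu lam c)) c => (x c : Submodule ℂ (V n)))
      (factorEquiv hle).symm := by
  classical
  refine ⟨fun H _ => finrank_richardson H, fun x c => finrank_factor hle (x c),
    fun H K h => Subtype.ext (congrFun h ()),
    fun x y h => funext fun c => Subtype.ext (congrFun h c), fun H c => ?_⟩
  -- the part of `H` is its coordinate projection, so it is spanned by the projections of a frame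
  have hspan : ∀ (K : ↥(schubert mu ∩ schubertOpp lam)) (M : Unit → Fin n → V n),
      IsFrame M (fun _ => (K : Submodule ℂ (V n))) →
      Submodule.span ℂ (Set.range (coordProj n (factorSupport c) ∘ M ())) =
        part (K : Submodule ℂ (V n)) c := by
    intro K M hM
    obtain ⟨h1, -, h3⟩ := (mem_richardson_iff.1 K.2).part_spec hle c
    rw [Set.range_comp, ← Submodule.map_span, (hM ()).2, h1]
    refine le_antisymm ?_ ?_
    · rintro _ ⟨x, hx, rfl⟩
      exact ⟨h3 x hx, coordProj_mem _ _⟩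
    · rintro x ⟨hx, hx'⟩
      exact ⟨x, hx, coordProj_eq_self hx'⟩
  let b := Module.finBasisOfFinrankEq ℂ (H : Submodule ℂ (V n)) (finrank_richardson H)
  let M : Unit → Fin n → V n := fun _ => Subtype.val ∘ b
  have hM : IsFrame M (fun _ => (H : Submodule ℂ (V n))) := by
    refine fun _ => ⟨b.linearIndependent.map' (Submodule.subtype _)
      (Submodule.ker_subtype _), ?_⟩
    rw [Set.range_comp, ← Submodule.coe_subtype, ← Submodule.map_span, b.span_eq,
      Submodule.map_subtype_top]
  -- choose rows of `M` whose projections are a basis of the part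
  obtain ⟨κ, a, ha, hsp, hli⟩ :=
    exists_linearIndependent' ℂ (coordProj n (factorSupport c) ∘ M ())
  rw [hspan H M hM] at hsp
  have : Finite κ := Finite.of_injective a ha
  cases nonempty_fintype κ
  have hcard : Fintype.card (Fin (factorDim c)) = Fintype.card κ := by
    rw [← finrank_span_eq_card hli, hsp, Fintype.card_fin]
    exact (finrank_factor hle ((factorEquiv hle).symm H c)).symm
  let f := Fintype.equivOfCardEq hcard
  let g : Fin (factorDim c) → Idx n → MvPolynomial (Σ _ : Unit, Fin n × Idx n) ℂ := fun r s =>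
    if (s : ℤ) ∈ factorSupport c then MvPolynomial.X ⟨(), a (f r), s⟩ else 0
  have hg : ∀ M : Unit → Fin n → V n,
      evalAt g M = (coordProj n (factorSupport c) ∘ M ()) ∘ (a ∘ f) := by
    intro M
    ext r s
    simp only [evalAt, g, Function.comp_apply, coordProj_apply]
    split_ifs <;> simp
  refine ⟨g, ⟨M, hM, ?_⟩, fun K M' hM' hli' => ?_⟩
  · rw [hg]
    exact hli.comp f f.injective
  · refine Submodule.eq_of_le_of_finrank_eq ?_ ?_
    · change _ ≤ part (K : Submodule ℂ (V n)) c
      rw [← hspan K M' hM', hg]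
      exact Submodule.span_mono (Set.range_comp_subset_range _ _)
    · rw [finrank_span_eq_card hli', Fintype.card_fin]
      exact (finrank_factor hle _).symm

end Regularity

/-! ### A factor as a Richardson variety of a smaller quadratic space -/

/-- The map `i ↦ i + s`, `-i ↦ -(i + s)` for `i > 0`, which fixes `0`. -/
def indexShift (s i : ℤ) : ℤ := i + Int.sign i * s

/-- The linear map with `e_0 ↦ e_0` and `e_{±i} ↦ e_{±(i+s)}` for `1 ≤ i ≤ p`. -/
noncomputable def shiftEmb (n p : ℕ) (s : ℤ) : V p →ₗ[ℂ] V n :=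
  Fintype.linearCombination ℂ (fun i : Idx p => e n (indexShift s i))

section shiftEmb

variable {n p : ℕ} {s : ℤ}

lemma indexShift_cases (s i : ℤ) : (0 < i ∧ indexShift s i = i + s) ∨
    (i = 0 ∧ indexShift s i = 0) ∨ (i < 0 ∧ indexShift s i = i - s) := by
  rcases lt_trichotomy i 0 with h | h | h
  · simp [indexShift, Int.sign_eq_neg_one_of_neg h, h, sub_eq_add_neg]
  · simp [indexShift, h]
  · simp [indexShift, Int.sign_eq_one_of_pos h, h]

lemma indexShift_strictMono (hs : 0 ≤ s) : StrictMono (indexShift s) := by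
  intro i j h
  rcases indexShift_cases s i with h1 | h1 | h1 <;> rcases indexShift_cases s j with h2 | h2 | h2 <;>
    omega

lemma exists_preimage_indexShift_Ici (hs : 0 ≤ s) (t : ℤ) :
    ∃ t', indexShift s ⁻¹' Set.Ici t = Set.Ici t' := by
  refine ⟨if 0 < t then max 1 (t - s) else min 0 (t + s), ?_⟩
  ext i
  simp only [Set.mem_preimage, Set.mem_Ici]
  rcases indexShift_cases s i with h1 | h1 | h1 <;> split_ifs <;> omega

lemma exists_preimage_indexShift_Iic (hs : 0 ≤ s) (t : ℤ) :
    ∃ t', indexShift s ⁻¹' Set.Iic t = Set.Iic t' := by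
  refine ⟨if t < 0 then min (-1) (t + s) else max 0 (t - s), ?_⟩
  ext i
  simp only [Set.mem_preimage, Set.mem_Iic]
  rcases indexShift_cases s i with h1 | h1 | h1 <;> split_ifs <;> omega

lemma shiftEmb_apply (x : V p) (k : Idx n) :
    shiftEmb n p s x k = ∑ i : Idx p, x i * e n (indexShift s i) k := by
  simp [shiftEmb, Fintype.linearCombination_apply]

lemma shiftEmb_apply_of_eq (hs : 0 ≤ s) (x : V p) {k : Idx n} {i : Idx p}
    (h : (k : ℤ) = indexShift s i) : shiftEmb n p s x k = x i := by
  rw [shiftEmb_apply, Finset.sum_eq_single i]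
  · simp [e, h]
  · intro j _ hj
    have : (k : ℤ) ≠ indexShift s j := fun hk =>
      hj (Subtype.ext ((indexShift_strictMono hs).injective (hk.symm.trans h)))
    simp [e, this]
  · simp

lemma shiftEmb_apply_of_ne (x : V p) {k : Idx n} (h : ∀ i : Idx p, (k : ℤ) ≠ indexShift s i) :
    shiftEmb n p s x k = 0 := by
  rw [shiftEmb_apply]
  exact Finset.sum_eq_zero fun i _ => by simp [e, h i]

lemma indexShift_mem (hs : 0 ≤ s) (hn : s + p ≤ n) (i : Idx p) :
    indexShift s i ∈ Finset.Icc (-(n : ℤ)) n := by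
  have := Finset.mem_Icc.1 i.2
  rw [Finset.mem_Icc]
  rcases indexShift_cases s i with h1 | h1 | h1 <;> omega

lemma shiftEmb_injective (hs : 0 ≤ s) (hn : s + p ≤ n) :
    Function.Injective (shiftEmb n p s) := by
  intro x y hxy
  ext i
  have := congrFun hxy ⟨_, indexShift_mem hs hn i⟩
  rwa [shiftEmb_apply_of_eq hs x rfl, shiftEmb_apply_of_eq hs y rfl] at this

lemma shiftEmb_mem_coordSpan (hs : 0 ≤ s) (hn : s + p ≤ n) (T : Set ℤ) (x : V p) :
    shiftEmb n p s x ∈ coordSpan n T ↔ x ∈ coordSpan p (indexShift s ⁻¹' T) := by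
  simp only [mem_coordSpan]
  constructor
  · intro h i hi
    rw [← shiftEmb_apply_of_eq hs x (k := ⟨_, indexShift_mem hs hn i⟩) rfl]
    exact h _ hi
  · intro h k hk
    by_cases hex : ∃ i : Idx p, (k : ℤ) = indexShift s i
    · obtain ⟨i, hi⟩ := hex
      rw [shiftEmb_apply_of_eq hs x hi]
      exact h i fun hT => hk (by rw [hi]; exact hT)
    · exact shiftEmb_apply_of_ne x (not_exists.1 hex)

lemma map_shiftEmb_inf_coordSpan (hs : 0 ≤ s) (hn : s + p ≤ n) (K : Submodule ℂ (V p))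
    (T : Set ℤ) : K.map (shiftEmb n p s) ⊓ coordSpan n T =
      (K ⊓ coordSpan p (indexShift s ⁻¹' T)).map (shiftEmb n p s) := by
  ext y
  constructor
  · rintro ⟨⟨x, hx, rfl⟩, hy⟩
    exact ⟨x, ⟨hx, (shiftEmb_mem_coordSpan hs hn T x).1 hy⟩, rfl⟩
  · rintro ⟨x, ⟨hx, hx'⟩, rfl⟩
    exact ⟨⟨x, hx, rfl⟩, (shiftEmb_mem_coordSpan hs hn T x).2 hx'⟩

lemma finrank_map_shiftEmb (hs : 0 ≤ s) (hn : s + p ≤ n) (K : Submodule ℂ (V p)) :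
    Module.finrank ℂ ↥(K.map (shiftEmb n p s)) = Module.finrank ℂ K :=
  (LinearEquiv.finrank_eq
    (Submodule.equivMapOfInjective _ (shiftEmb_injective hs hn) K)).symm

lemma shiftEmb_e (i : Idx p) : shiftEmb n p s (e p i) = e n (indexShift s i) := by
  ext k
  rw [shiftEmb_apply, Finset.sum_eq_single i]
  · simp [e]
  · intro j _ hj
    have : (j : ℤ) ≠ i := fun h => hj (Subtype.ext h)
    simp [e, this]
  · simp

/-- The embedding is an isometry. -/
lemma beta_shiftEmb (hs : 0 ≤ s) (hn : s + p ≤ n) (x y : V p) :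
    beta n (shiftEmb n p s x) (shiftEmb n p s y) = beta p x y := by
  have key : (beta n).comp (shiftEmb n p s) (shiftEmb n p s) = beta p := by
    refine LinearMap.BilinForm.ext_basis (Pi.basisFun ℂ (Idx p)) fun i j => ?_
    have hb : ∀ i : Idx p, Pi.basisFun ℂ (Idx p) i = e p i := by
      intro i
      ext k
      rw [Pi.basisFun_apply, Pi.single_apply]
      exact if_congr Subtype.ext_iff rfl rfl
    have hj := Finset.mem_Icc.1 j.2
    let m : Idx p := ⟨-j, Finset.mem_Icc.2 (by omega)⟩
    have hneg : indexShift s m = -indexShift s j := by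
      simp only [m, indexShift, Int.sign_neg]
      ring
    rw [LinearMap.BilinForm.comp_apply, hb, hb, shiftEmb_e j,
      beta_e_right (e p i) m j rfl]
    refine (beta_e_right _ ⟨_, indexShift_mem hs hn m⟩ ⟨_, indexShift_mem hs hn j⟩ hneg).trans ?_
    exact shiftEmb_apply_of_eq hs _ rfl
  exact congrArg (fun B : LinearMap.BilinForm ℂ (V p) => B x y) key

variable {mu : SY n} {mu' : SY p} {S : Set ℤ}

lemma entryCount_inter_eq (hs : 0 ≤ s)
    (hmu : Set.range mu.seq ∩ S = indexShift s '' Set.range mu'.seq) (U : Set ℤ) :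
    entryCount mu (S ∩ U) = entryCount mu' (indexShift s ⁻¹' U) := by
  rw [entryCount, ← Set.inter_assoc, hmu, ← Set.image_inter_preimage,
    Set.ncard_image_of_injective _ (indexShift_strictMono hs).injective]
  rfl

lemma entryCount_eq_of_image_eq (hs : 0 ≤ s)
    (hmu : Set.range mu.seq ∩ S = indexShift s '' Set.range mu'.seq) : entryCount mu S = p := by
  rw [← Set.inter_univ S, entryCount_inter_eq hs hmu, Set.preimage_univ, entryCount_univ]

variable {lam : SY n} {lam' : SY p}

lemma isPiece_map_shiftEmb_iff (hs : 0 ≤ s) (hn : s + p ≤ n)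
    (hmu : Set.range mu.seq ∩ S = indexShift s '' Set.range mu'.seq)
    (hlam : Set.range lam.seq ∩ S = indexShift s '' Set.range lam'.seq)
    {K : Submodule ℂ (V p)} : IsPiece mu lam S (K.map (shiftEmb n p s)) ↔
      IsPiece mu' lam' Set.univ K ∧ K.map (shiftEmb n p s) ≤ coordSpan n S := by
  constructor
  · intro h
    refine ⟨⟨by simp [coordSpan_univ], fun x hx y hy => ?_, ?_, fun t => ?_, fun t => ?_⟩,
      h.le_coordSpan⟩
    · rw [← beta_shiftEmb hs hn]
      exact h.isotropic _ ⟨x, hx, rfl⟩ _ ⟨y, hy, rfl⟩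
    · rw [← finrank_map_shiftEmb hs hn, h.finrank_eq, entryCount_eq_of_image_eq hs hmu,
        entryCount_univ]
    · have ht : indexShift s ⁻¹' Set.Ici (indexShift s t) = Set.Ici t := by
        ext i
        exact (indexShift_strictMono hs).le_iff_le
      have := h.le_finrank_Ici (indexShift s t)
      rw [entryCount_inter_eq hs hmu, map_shiftEmb_inf_coordSpan hs hn,
        finrank_map_shiftEmb hs hn, ht] at this
      rwa [Set.univ_inter]
    · have ht : indexShift s ⁻¹' Set.Iic (indexShift s t) = Set.Iic t := by
        ext i
        exact (indexShift_strictMono hs).le_iff_le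
      have := h.le_finrank_Iic (indexShift s t)
      rw [entryCount_inter_eq hs hlam, map_shiftEmb_inf_coordSpan hs hn,
        finrank_map_shiftEmb hs hn, ht] at this
      rwa [Set.univ_inter]
  · rintro ⟨h, hK⟩
    refine ⟨hK, ?_, ?_, fun t => ?_, fun t => ?_⟩
    · rintro _ ⟨x, hx, rfl⟩ _ ⟨y, hy, rfl⟩
      rw [beta_shiftEmb hs hn]
      exact h.isotropic x hx y hy
    · rw [finrank_map_shiftEmb hs hn, h.finrank_eq, entryCount_univ,
        entryCount_eq_of_image_eq hs hmu]
    · obtain ⟨t', ht⟩ := exists_preimage_indexShift_Ici hs t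
      rw [entryCount_inter_eq hs hmu, map_shiftEmb_inf_coordSpan hs hn,
        finrank_map_shiftEmb hs hn, ht]
      have := h.le_finrank_Ici t'
      rwa [Set.univ_inter] at this
    · obtain ⟨t', ht⟩ := exists_preimage_indexShift_Iic hs t
      rw [entryCount_inter_eq hs hlam, map_shiftEmb_inf_coordSpan hs hn,
        finrank_map_shiftEmb hs hn, ht]
      have := h.le_finrank_Iic t'
      rwa [Set.univ_inter] at this

lemma coordSpan_le_range_shiftEmb (hS : ∀ k ∈ S, ∃ i : Idx p, k = indexShift s i) :
    coordSpan n S ≤ LinearMap.range (shiftEmb n p s) := by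
  refine Submodule.span_le.2 ?_
  rintro _ ⟨k, hk, rfl⟩
  obtain ⟨i, rfl⟩ := hS k hk
  exact ⟨e p i, shiftEmb_e i⟩

/-- The entries of a sequence with absolute values in `[s + 1, s + p]`, shifted towards `0`, form
a sequence in `SY p`. -/
lemma exists_restriction (hs : 0 ≤ s) (hn : s + p ≤ n) (mu : SY n) : ∃ mu' : SY p,
    Set.range mu.seq ∩ {i | |i| ∈ Set.Icc (s + 1) (s + p)} =
      indexShift s '' Set.range mu'.seq := by
  classical
  let A : Finset ℤ :=
    (Finset.Icc (-(p : ℤ)) p).filter fun i => i ≠ 0 ∧ indexShift s i ∈ Set.range mu.seq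
  have hA : indexShift s '' (A : Set ℤ) =
      Set.range mu.seq ∩ {i | |i| ∈ Set.Icc (s + 1) (s + p)} := by
    ext v
    simp only [A, Finset.coe_filter, Finset.mem_Icc, Set.mem_image, Set.mem_ofPred_eq,
      Set.mem_inter_iff, Set.mem_Icc]
    constructor
    · rintro ⟨i, ⟨hi, h0, hr⟩, rfl⟩
      refine ⟨hr, ?_⟩
      rcases indexShift_cases s i with h1 | h1 | h1 <;>
        rcases abs_cases (indexShift s i) with h2 | h2 <;> omega
    · rintro ⟨hr, hv⟩
      rcases abs_cases v with h2 | h2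
      · have h3 : indexShift s (v - s) = v := by
          rcases indexShift_cases s (v - s) with h1 | h1 | h1 <;> omega
        exact ⟨v - s, ⟨by omega, by omega, by rwa [h3]⟩, h3⟩
      · have h3 : indexShift s (v + s) = v := by
          rcases indexShift_cases s (v + s) with h1 | h1 | h1 <;> omega
        exact ⟨v + s, ⟨by omega, by omega, by rwa [h3]⟩, h3⟩
  have hcard : A.card = p := by
    have h1 := entryCount_abs_preimage mu (Set.Icc (s + 1) (s + p)) (fun i hi => by
      simp only [Set.mem_Icc] at hi ⊢; omega)
    rw [entryCount, ← hA, Set.ncard_image_of_injective _ (indexShift_strictMono hs).injective,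
      Set.ncard_coe_finset, ← Finset.coe_Icc, Set.ncard_coe_finset, Int.card_Icc] at h1
    omega
  have hrange : Set.range (fun j : Fin p => A.orderEmbOfFin hcard j.rev) = A := by
    rw [← Finset.range_orderEmbOfFin A hcard]
    exact Fin.rev_surjective.range_comp (A.orderEmbOfFin hcard)
  refine ⟨⟨fun j => A.orderEmbOfFin hcard j.rev, fun i j h =>
    (A.orderEmbOfFin hcard).strictMono (Fin.rev_lt_rev.2 h), ?_⟩, ?_⟩
  · rw [show (fun j : Fin p => |A.orderEmbOfFin hcard j.rev|) =
      abs ∘ (fun j : Fin p => A.orderEmbOfFin hcard j.rev) from rfl, Set.range_comp, hrange]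
    ext k
    constructor
    · rintro ⟨i, hi, rfl⟩
      simp only [A, Finset.coe_filter, Finset.mem_Icc, Set.mem_ofPred_eq] at hi
      rw [Set.mem_Icc]
      rcases abs_cases i with h | h <;> omega
    · rintro ⟨h1, h2⟩
      have : s + k ∈ Set.Icc (1 : ℤ) n := ⟨by omega, by omega⟩
      rw [← mu.range_abs] at this
      obtain ⟨j, hj⟩ := this
      simp only at hj
      have hmem : mu.seq j ∈ indexShift s '' (A : Set ℤ) := by
        rw [hA]
        exact ⟨⟨j, rfl⟩, by rw [Set.mem_ofPred_eq, hj]; exact ⟨by omega, by omega⟩⟩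
      obtain ⟨i, hi, hij⟩ := hmem
      refine ⟨i, hi, ?_⟩
      rw [← hij] at hj
      rcases indexShift_cases s i with h1 | h1 | h1 <;>
        rcases abs_cases (indexShift s i) with h2 | h2 <;>
        rcases abs_cases i with h3 | h3 <;> omega
  · exact hA.symm.trans (congrArg _ hrange.symm)

end shiftEmb

section FactorEmb

variable {n : ℕ} {mu lam : SY n}

/-- If a factor has no positive column, then `factorShift` is the junk value `-1`; since then only
`e_0` is to be embedded, it can be replaced by `0`. -/
lemma exists_shift (c : FactorIdx mu lam) : ∃ s : ℤ, 0 ≤ s ∧ s + factorDim c ≤ n ∧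
    factorCols c = Set.Icc (s + 1) (s + factorDim c) ∧
    (factorShift c = s ∨ factorDim c = 0) := by
  have key : ∀ p q : ℤ, 1 ≤ p → p ≤ q → q ≤ n + 1 →
      factorCols c = Set.Ico p q → ∃ s : ℤ, 0 ≤ s ∧ s + factorDim c ≤ n ∧
        factorCols c = Set.Icc (s + 1) (s + factorDim c) ∧
        (factorShift c = s ∨ factorDim c = 0) := by
    intro p q h1 h2 h3 hc
    have hdim : (factorDim c : ℤ) = q - p := by
      rw [factorDim, hc, ← Finset.coe_Ico, Set.ncard_coe_finset, Int.card_Ico]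
      omega
    refine ⟨p - 1, by omega, by omega, ?_, ?_⟩
    · rw [hc]
      ext i
      simp only [Set.mem_Ico, Set.mem_Icc]
      omega
    · rcases h2.eq_or_lt with h | h
      · right
        omega
      · left
        have hl : IsLeast (Set.Ico p q) p := ⟨⟨le_rfl, h⟩, fun x hx => hx.1⟩
        rw [factorShift, hc, hl.csInf_eq]
  match c with
  | none =>
    obtain ⟨q, h1, h2, -, -, hc⟩ := exists_factorCols_none (mu := mu) (lam := lam)
    exact key 1 q le_rfl h1 h2 hc
  | some d =>
    obtain ⟨p, q, h1, h2, h3, -, -, -, -, hc⟩ := exists_factorCols_some d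
    exact key p q h1 h2.le h3 hc

lemma factorEmb_eq {c : FactorIdx mu lam} {s : ℤ}
    (h : factorShift c = s ∨ factorDim c = 0) : factorEmb c = shiftEmb n (factorDim c) s := by
  unfold factorEmb shiftEmb
  congr 1
  ext i : 1
  rcases h with h | h
  · rw [h, indexShift]
  · have hi := Finset.mem_Icc.1 i.2
    rw [show (i : ℤ) = 0 by omega]
    simp [indexShift]

lemma range_inter_factorSupport (nu : SY n) (c : FactorIdx mu lam) :
    Set.range nu.seq ∩ factorSupport c = Set.range nu.seq ∩ {i | |i| ∈ factorCols c} := by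
  ext i
  exact and_congr_right fun hi => mem_factorSupport_iff (SY.ne_zero_of_mem_range hi)

lemma isRestriction_of_image_eq {c : FactorIdx mu lam} {s : ℤ} (hs : 0 ≤ s)
    (h : factorShift c = s ∨ factorDim c = 0) {nu : SY n} {nu' : SY (factorDim c)}
    (hnu : Set.range nu.seq ∩ {i | |i| ∈ factorCols c} = indexShift s '' Set.range nu'.seq) :
    IsRestriction c nu nu' := by
  unfold IsRestriction
  have : {v ∈ Set.range nu.seq | |v| ∈ factorCols c} =
    Set.range nu.seq ∩ {i | |i| ∈ factorCols c} := rfl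
  rw [this, hnu, Set.image_image]
  refine ((Set.image_congr fun i hi => ?_).trans (Set.image_id _)).symm
  obtain ⟨j, rfl⟩ := hi
  have hpos := j.2
  rw [h.resolve_right (by omega), id]
  rcases indexShift_cases s (nu'.seq j) with h1 | h1 | h1
  · rw [h1.2, Int.sign_eq_one_of_pos (by omega)]
    ring
  · rw [h1.2, h1.1]
    simp
  · rw [h1.2, Int.sign_eq_neg_one_of_neg (by omega)]
    ring

/-- Two Schubert varieties in opposite position meet only if their indices are comparable. -/
lemma IsPiece.bruhatLE {H : Submodule ℂ (V n)} (hH : IsPiece mu lam Set.univ H) :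
    bruhatLE mu lam := by
  intro j
  by_contra! hlt
  have h1 := hH.le_finrank_Ici (mu.seq j)
  have h2 := hH.le_finrank_Iic (lam.seq j)
  rw [Set.univ_inter] at h1 h2
  have h3 := (lt_entryCount_Ici_iff mu _ j).2 le_rfl
  have h4 := (sub_le_entryCount_Iic_iff lam _ j).2 le_rfl
  have h5 := finrank_inf_add_finrank_inf_le (S := Set.Ici (mu.seq j)) (T := Set.Iic (lam.seq j))
    (Set.disjoint_left.2 fun i hi hi' => absurd (hlt.trans_le hi) (not_lt.2 hi')) H
  rw [hH.finrank_eq, entryCount_univ] at h5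
  omega

/-- If `1` is a cut, then so is `0`, and `H` has no component along `e_0`. -/
lemma le_coordSpan_ne_zero (h1 : IsCut mu lam 1) {H : Submodule ℂ (V n)}
    (hH : IsPiece mu lam Set.univ H) : H ≤ coordSpan n {i | i ≠ 0} := by
  have h0 : IsCut mu lam 0 := by simpa using h1.one_sub le_rfl (by omega)
  have h2 := (h0.isPiece_Ico hH h1 zero_le_one).finrank_eq
  have h3 : entryCount mu (Set.Ico 0 1) = 0 := by
    rw [entryCount, Set.ncard_eq_zero (mu.finite_range_inter _)]
    refine Set.eq_empty_of_forall_notMem ?_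
    rintro i ⟨hi, h4, h5⟩
    exact SY.ne_zero_of_mem_range hi (by omega)
  rw [h3, Submodule.finrank_eq_zero] at h2
  intro x hx
  have h4 : coordProj n (Set.Ico 0 1) x ∈ H ⊓ coordSpan n (Set.Ico 0 1) :=
    ⟨h0.coordProj_Ico_mem hH h1 zero_le_one hx, coordProj_mem _ _⟩
  rw [h2, Submodule.mem_bot] at h4
  refine mem_coordSpan.2 fun k hk => ?_
  have h5 := congrFun h4 k
  rwa [coordProj_apply, if_pos] at h5
  simp only [Set.mem_ofPred_eq, not_not] at hk
  rw [hk]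
  exact ⟨le_rfl, one_pos⟩

/-- In a factor without `e_0`, the two sequences have equally many positive entries, so that `1`
is a cut for their restrictions. -/
lemma map_shiftEmb_le_coordSpan (hle : bruhatLE mu lam) (c : FactorIdx mu lam) {s : ℤ}
    (hs : 0 ≤ s) (hn : s + factorDim c ≤ n)
    (hc : factorCols c = Set.Icc (s + 1) (s + factorDim c)) {mu' lam' : SY (factorDim c)}
    (hmu : Set.range mu.seq ∩ factorSupport c = indexShift s '' Set.range mu'.seq)
    (hlam : Set.range lam.seq ∩ factorSupport c = indexShift s '' Set.range lam'.seq)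
    {K : Submodule ℂ (V (factorDim c))} (hK : IsPiece mu' lam' Set.univ K) :
    K.map (shiftEmb n (factorDim c) s) ≤ coordSpan n (factorSupport c) := by
  have hmem : ∀ i : Idx (factorDim c), (i : ℤ) ≠ 0 → indexShift s i ∈ factorSupport c := by
    intro i hi
    have := Finset.mem_Icc.1 i.2
    rw [mem_factorSupport_iff (by rcases indexShift_cases s i with h1 | h1 | h1 <;> omega), hc,
      Set.mem_Icc]
    rcases indexShift_cases s i with h1 | h1 | h1 <;>
      rcases abs_cases (indexShift s i) with h2 | h2 <;> omega
  suffices K ≤ coordSpan (factorDim c) (indexShift s ⁻¹' factorSupport c) by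
    rintro _ ⟨x, hx, rfl⟩
    exact (shiftEmb_mem_coordSpan hs hn _ x).2 (this hx)
  match c with
  | none =>
    intro x _
    refine mem_coordSpan.2 fun i hi => absurd ?_ hi
    by_cases h0 : (i : ℤ) = 0
    · rw [h0]
      exact Or.inl (by simp [indexShift])
    · exact hmem i h0
  | some d =>
    obtain ⟨p, q, h1, h2, h3, hp, hq, -, -, hc'⟩ := exists_factorCols_some d
    have hp' := (isCut_iff_not_meetsColumn hle h1).2 hp
    have hq' := (isCut_iff_not_meetsColumn hle (h1.trans h2.le)).2 hq
    have hcut : IsCut mu' lam' 1 := by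
      have ht : indexShift s ⁻¹' Set.Ici 1 = Set.Ici 1 := by
        ext i
        simp only [Set.mem_preimage, Set.mem_Ici]
        rcases indexShift_cases s i with h1 | h1 | h1 <;> omega
      have hI : factorSupport (some d) ∩ Set.Ici 1 = Set.Ico p q := by
        ext i
        simp only [factorSupport, hc', Set.mem_inter_iff, Set.mem_ofPred_eq, Set.mem_Ico,
          Set.mem_Ici]
        rcases abs_cases i with h | h <;> omega
      rw [IsCut, ← ht, ← entryCount_inter_eq hs hmu, ← entryCount_inter_eq hs hlam, hI]
      have h4 := entryCount_Ico_add_Ici mu h2.le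
      have h5 := entryCount_Ico_add_Ici lam h2.le
      unfold IsCut at hp' hq'
      omega
    intro x hx
    refine mem_coordSpan.2 fun i hi => ?_
    exact mem_coordSpan.1 (le_coordSpan_ne_zero hcut hK hx) i fun h0 => hi (hmem i h0)

lemma exists_eq_indexShift {c : FactorIdx mu lam} {s : ℤ}
    (hc : factorCols c = Set.Icc (s + 1) (s + factorDim c)) {k : ℤ} (hk : k ∈ factorSupport c) :
    ∃ i : Idx (factorDim c), k = indexShift s i := by
  by_cases h0 : k = 0
  · exact ⟨⟨0, Finset.mem_Icc.2 (by omega)⟩, by simp [h0, indexShift]⟩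
  rw [mem_factorSupport_iff h0, hc, Set.mem_Icc] at hk
  rcases abs_cases k with h | h
  · refine ⟨⟨k - s, Finset.mem_Icc.2 (by omega)⟩, ?_⟩
    rcases indexShift_cases s (k - s) with h1 | h1 | h1 <;> simp only <;> omega
  · refine ⟨⟨k + s, Finset.mem_Icc.2 (by omega)⟩, ?_⟩
    rcases indexShift_cases s (k + s) with h1 | h1 | h1 <;> simp only <;> omega

lemma exists_factor_eq_image (hle : bruhatLE mu lam) (c : FactorIdx mu lam) :
    ∃ mu' lam' : SY (factorDim c),
      IsRestriction c mu mu' ∧ IsRestriction c lam lam' ∧ bruhatLE mu' lam' ∧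
      factor mu lam c =
        Submodule.map (factorEmb c) '' (schubert mu' ∩ schubertOpp lam') := by
  obtain ⟨s, hs, hn, hc, hshift⟩ := exists_shift c
  obtain ⟨mu', hmu⟩ := exists_restriction hs hn mu
  obtain ⟨lam', hlam⟩ := exists_restriction hs hn lam
  rw [← hc] at hmu hlam
  have hmu' := (range_inter_factorSupport mu c).trans hmu
  have hlam' := (range_inter_factorSupport lam c).trans hlam
  have heq : factor mu lam c =
      Submodule.map (factorEmb c) '' (schubert mu' ∩ schubertOpp lam') := by
    rw [factorEmb_eq hshift]
    ext W
    rw [mem_factor_iff hle]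
    constructor
    · intro hW
      have hmap : (W.comap (shiftEmb n (factorDim c) s)).map (shiftEmb n (factorDim c) s) = W :=
        Submodule.map_comap_eq_of_le (hW.le_coordSpan.trans
          (coordSpan_le_range_shiftEmb fun k => exists_eq_indexShift hc))
      rw [← hmap, isPiece_map_shiftEmb_iff hs hn hmu' hlam'] at hW
      exact ⟨_, mem_richardson_iff.2 hW.1, hmap⟩
    · rintro ⟨K, hK, rfl⟩
      rw [mem_richardson_iff] at hK
      exact (isPiece_map_shiftEmb_iff hs hn hmu' hlam').2
        ⟨hK, map_shiftEmb_le_coordSpan hle c hs hn hc hmu' hlam' hK⟩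
  refine ⟨mu', lam', isRestriction_of_image_eq hs hshift hmu,
    isRestriction_of_image_eq hs hshift hlam, ?_, heq⟩
  -- the factor is not empty
  have hne : part (coordSpan n (Set.range mu.seq)) c ∈ factor mu lam c :=
    ⟨_, mem_richardson_iff.2 (isPiece_coordSpan_range hle), rfl⟩
  rw [heq] at hne
  obtain ⟨K, hK, -⟩ := hne
  exact (mem_richardson_iff.1 hK).bruhatLE

end FactorEmb

theorem theorem3 (n : ℕ) (mu lam : SY n) (hle : bruhatLE mu lam) :
    (∀ H ∈ schubert mu ∩ schubertOpp lam, H ⊓ Vphi mu lam = Hphi mu lam) ∧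
    (∃ E : ((c : FactorIdx mu lam) → ↥(factor mu lam c)) ≃ ↥(schubert mu ∩ schubertOpp lam),
      (∀ x : (c : FactorIdx mu lam) → ↥(factor mu lam c),
        (E x : Submodule ℂ (V n)) = Hphi mu lam ⊔ ⨆ c, (x c : Submodule ℂ (V n))) ∧
      IsRegularMap (factorDim (mu := mu) (lam := lam)) (fun _ : Unit => n)
        (fun (x : (c : FactorIdx mu lam) → ↥(factor mu lam c)) c => (x c : Submodule ℂ (V n)))
        (fun (H : ↥(schubert mu ∩ schubertOpp lam)) _ => (H : Submodule ℂ (V n))) E ∧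
      IsRegularMap (fun _ : Unit => n) (factorDim (mu := mu) (lam := lam))
        (fun (H : ↥(schubert mu ∩ schubertOpp lam)) _ => (H : Submodule ℂ (V n)))
        (fun (x : (c : FactorIdx mu lam) → ↥(factor mu lam c)) c => (x c : Submodule ℂ (V n)))
        E.symm) ∧
    (∀ c : FactorIdx mu lam, ∃ mu' lam' : SY (factorDim c),
      IsRestriction c mu mu' ∧ IsRestriction c lam lam' ∧ bruhatLE mu' lam' ∧
      factor mu lam c =
        Submodule.map (factorEmb c) '' (schubert mu' ∩ schubertOpp lam')) :=
  ⟨fun _ hH => inf_Vphi_eq (mem_richardson_iff.1 hH),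
    ⟨factorEquiv hle, fun _ => rfl, isRegularMap_factorEquiv hle,
      isRegularMap_factorEquiv_symm hle⟩,
    exists_factor_eq_image hle⟩
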